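/- Let $K$ be a field, $B$ an associative unital $K$-algebra, and $A\subseteq B$ a $K$-subalgebra. Suppose that $B$ is a \emph{double extension} $A_P[y_1,y_2;\sigma,\delta,\tau]$ of $A$, where $P=\{p_{12},p_{11}\}\subseteq K$, $\tau=\{\tau_0,\tau_1,\tau_2\}\subseteq A$ and $y_1,y_2\in B$; that is: (i) $B$ is generated as a $K$-algebra by $A$, $y_1$ and $y_2$; (ii) $y_2y_1=p_{12}y_1y_2+p_{11}y_1^2+\tau_1y_1+\tau_2y_2+\tau_0$, and $p_{12}\neq 0$; (iii) $B$ is a free left $A$-module with basis $\{y_1^iy_2^j : i,j\ge 0\}$ and a free right $A$-module with basis $\{y_2^iy_1^j : i,j\ge 0\}$; (iv) $y_1A+y_2A+A=Ay_1+Ay_2+A$; and $\sigma=\begin{bmatrix}\sigma_{11}&\sigma_{12}\\ \sigma_{21}&\sigma_{22}\end{bmatrix}\colon A\to M_{2\times 2}(A)$, $\delta=\begin{bmatrix}\delta_1\\ \delta_2\end{bmatrix}\colon A\to M_{2\times 1}(A)$ are the maps determined by $$\begin{bmatrix}y_1\\ y_2\end{bmatrix}a=\sigma(a)\begin{bmatrix}y_1\\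 y_2\end{bmatrix}+\delta(a)\qquad\text{for all } a\in A.$$ Assume that either $\sigma_{12}=0$, or both $\sigma_{21}=0$ and $p_{11}=0$. Let $\mathcal P$ be any one of the following properties of a ring: left noetherian; right noetherian; domain; prime; semiprime and left noetherian; semiprime and right noetherian; semiprime and left Goldie; semiprime and right Goldie. (A ring is left Goldie if it satisfies the ascending chain condition on left annihilators of subsets and contains no infinite direct sum of nonzero left ideals; right Goldie is defined symmetrically.) If $A$ has the property $\mathcal P$, then $B$ has the property $\mathcal P$. -/

import Mathlib

namespace DoubleOre

section RingProperties

variable (R : Type*) [Ring R]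

/-- Left noetherian: `R` is a noetherian left module over itself. -/
def IsLeftNoetherian : Prop := IsNoetherianRing R

/-- Right noetherian: the opposite ring is left noetherian. -/
def IsRightNoetherian : Prop := IsNoetherianRing Rᵐᵒᵖ

/-- A prime ring: `R ≠ 0`, and `a R b = 0` forces `a = 0` or `b = 0`. -/
def IsPrimeRing : Prop :=
  Nontrivial R ∧ ∀ a b : R, (∀ r : R, a * r * b = 0) → a = 0 ∨ b = 0

/-- A semiprime ring: `a R a = 0` forces `a = 0`. -/
def IsSemiprimeRing : Prop :=
  ∀ a : R, (∀ r : R, a * r * a = 0) → a = 0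

variable {R} in
/-- The left annihilator `{r | r S = 0}` of a subset `S`, as a left ideal. -/
def leftAnnihilator (S : Set R) : Ideal R where
  carrier := {r | ∀ s ∈ S, r * s = 0}
  add_mem' := by
    intro a b ha hb s hs
    rw [add_mul, ha s hs, hb s hs, add_zero]
  zero_mem' := fun s _ => zero_mul s
  smul_mem' := by
    intro c a ha s hs
    rw [smul_eq_mul, mul_assoc, ha s hs, mul_zero]

/-- A left Goldie ring: the ascending chain condition holds for left annihilators, and there is no
infinite direct sum of nonzero left ideals. -/
structure IsLeftGoldie : Prop where
  acc_annihilators : WellFoundedGT (Set.range (leftAnnihilator : Set R → Ideal R))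
  no_infinite_direct_sum : ∀ I : ℕ → Ideal R, iSupIndep I → ∃ n, I n = ⊥

/-- Right Goldie: the opposite ring is left Goldie. -/
def IsRightGoldie : Prop := IsLeftGoldie Rᵐᵒᵖ

end RingProperties

/-- The family `v` is a basis of the left `R`-module `M`. -/
def IsFreeBasis (R : Type*) {M ι : Type*} [Ring R] [AddCommGroup M] [Module R M]
    (v : ι → M) : Prop :=
  LinearIndependent R v ∧ Submodule.span R (Set.range v) = ⊤

section DoubleExtension

variable {K B : Type*} [Field K] [Ring B] [Algebra K B]

/-- The subset `A y₁ + A y₂ + A` of `B`. -/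
def leftLinear (A : Subalgebra K B) (y₁ y₂ : B) : Set B :=
  {b | ∃ a₁ a₂ a₀ : A, b = a₁ * y₁ + a₂ * y₂ + a₀}

/-- The subset `y₁ A + y₂ A + A` of `B`. -/
def rightLinear (A : Subalgebra K B) (y₁ y₂ : B) : Set B :=
  {b | ∃ a₁ a₂ a₀ : A, b = y₁ * a₁ + y₂ * a₂ + a₀}

/-- `B` is a right double extension of its subalgebra `A`, with variables `y₁, y₂`, parameter
`{p₁₂, p₁₁}` and tail `{τ₀, τ₁, τ₂}`. -/
structure IsRightDoubleExtension (A : Subalgebra K B) (y₁ y₂ : B) (p₁₂ p₁₁ : K)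
    (τ₀ τ₁ τ₂ : A) : Prop where
  generated : Algebra.adjoin K ((A : Set B) ∪ {y₁, y₂}) = ⊤
  relation : y₂ * y₁ = p₁₂ • (y₁ * y₂) + p₁₁ • y₁ ^ 2 + τ₁ * y₁ + τ₂ * y₂ + τ₀
  left_basis : IsFreeBasis A (fun n : ℕ × ℕ => y₁ ^ n.1 * y₂ ^ n.2)
  right_subset_left : rightLinear A y₁ y₂ ⊆ leftLinear A y₁ y₂

/-- `B` is a double extension of its subalgebra `A`. The right `A`-module `B` is viewed as the left
module `Bᵐᵒᵖ` over the opposite subalgebra `A.op`. -/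
structure IsDoubleExtension (A : Subalgebra K B) (y₁ y₂ : B) (p₁₂ p₁₁ : K)
    (τ₀ τ₁ τ₂ : A) : Prop extends IsRightDoubleExtension A y₁ y₂ p₁₂ p₁₁ τ₀ τ₁ τ₂ where
  p₁₂_ne_zero : p₁₂ ≠ 0
  right_basis : IsFreeBasis A.op (fun n : ℕ × ℕ => MulOpposite.op (y₂ ^ n.1 * y₁ ^ n.2))
  right_eq_left : rightLinear A y₁ y₂ = leftLinear A y₁ y₂

/-- The maps `σ : A → M₂ₓ₂(A)` and `δ : A → M₂ₓ₁(A)` are those of the extension: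
`(y₁, y₂)ᵗ a = σ(a) (y₁, y₂)ᵗ + δ(a)`. The indices `0, 1` stand for `1, 2`. -/
def IsStructureMaps (A : Subalgebra K B) (y₁ y₂ : B)
    (σ : A → Matrix (Fin 2) (Fin 2) A) (δ : A → Fin 2 → A) : Prop :=
  ∀ a : A,
    y₁ * a = σ a 0 0 * y₁ + σ a 0 1 * y₂ + δ a 0 ∧
    y₂ * a = σ a 1 0 * y₁ + σ a 1 1 * y₂ + δ a 1

end DoubleExtension

end DoubleOre

/-!
If `σ₁₂ = 0`, then `y₁` commutes with `A` up to lower terms, and comparing coefficients in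
`y₂ (y₁ b) = (y₂ y₁) b` shows that it does so from both sides. Hence `C = A[y₁]` is an Ore extension
of `A` and `B = C[y₂]` is one of `C`, both with bijective twist. If `σ₂₁ = 0` and `p₁₁ = 0`, solving
the relation for `y₁ y₂` shows that `B` is also a double extension in the variables `y₂, y₁`: each
`y₂ⁱ y₁ʲ` is a nonzero multiple of `y₁ʲ y₂ⁱ` up to lower total degree.

The properties pass up an Ore extension `S = R[y; σ, δ]` with bijective `σ` by taking leading
coefficients, which multiply up to powers of `σ`. If `s S s = 0`, the leading coefficient `a` of
`s` gives pairwise orthogonal elements `σᵏⁱ(a)`, which span an infinite direct sum of left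
ideals. If `R` has finite uniform rank `u`, the elements of degree less than `n` have rank at
most `n u`, whereas each nonzero left ideal eventually contributes to every degree; so `S` has no
`u + 1` independent ones. Semiprime left Goldie rings are left nonsingular, nonsingularity passes
to `S`, and there finite rank gives back the chain condition on annihilators.
-/

namespace DoubleOre

open MulOpposite

section OreExtension

variable {R S : Type*} [Ring R] [Ring S] {ι : R →+* S} {y : S} {σ : R ≃+* R}

/-- The polynomials `∑ ι(rᵢ) yⁱ` of degree less than `n` in `y`, with coefficients on the left. -/
def degreeLT (ι : R →+* S) (y : S) : ℕ → AddSubgroup S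
  | 0 => ⊥
  | n + 1 => degreeLT ι y n ⊔ ((AddMonoidHom.mulRight (y ^ n)).comp ι.toAddMonoidHom).range

theorem mem_degreeLT_zero {s : S} : s ∈ degreeLT ι y 0 ↔ s = 0 := Iff.rfl

theorem mem_degreeLT_succ {n : ℕ} {s : S} :
    s ∈ degreeLT ι y (n + 1) ↔ ∃ r : R, s - ι r * y ^ n ∈ degreeLT ι y n := by
  rw [degreeLT, AddSubgroup.mem_sup]
  constructor
  · rintro ⟨t, ht, _, ⟨r, rfl⟩, rfl⟩
    exact ⟨r, by simpa using ht⟩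
  · rintro ⟨r, hr⟩
    exact ⟨_, hr, _, ⟨r, rfl⟩, sub_add_cancel _ _⟩

theorem degreeLT_mono : Monotone (degreeLT ι y) :=
  monotone_nat_of_le_succ fun _ => le_sup_left

theorem map_mul_pow_mem_degreeLT {n m : ℕ} (h : n < m) (r : R) : ι r * y ^ n ∈ degreeLT ι y m :=
  degreeLT_mono h (mem_degreeLT_succ.2 ⟨r, by simp⟩)

theorem degreeLT_le {n : ℕ} {H : AddSubgroup S} (hH : ∀ i < n, ∀ r, ι r * y ^ i ∈ H) :
    degreeLT ι y n ≤ H := by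
  induction n with
  | zero => exact bot_le
  | succ n ih =>
    refine sup_le (ih fun i hi => hH i (hi.trans n.lt_succ_self)) ?_
    rintro _ ⟨r, rfl⟩
    exact hH n n.lt_succ_self r

theorem map_mul_mem_degreeLT {n : ℕ} (r : R) {s : S} (hs : s ∈ degreeLT ι y n) :
    ι r * s ∈ degreeLT ι y n := by
  suffices degreeLT ι y n ≤ (degreeLT ι y n).comap (AddMonoidHom.mulLeft (ι r)) from this hs
  refine degreeLT_le fun i hi r' => ?_
  simpa [mul_assoc] using map_mul_pow_mem_degreeLT (y := y) (ι := ι) hi (r * r')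

theorem mul_pow_mem_degreeLT {n : ℕ} (k : ℕ) {s : S} (hs : s ∈ degreeLT ι y n) :
    s * y ^ k ∈ degreeLT ι y (n + k) := by
  suffices degreeLT ι y n ≤ (degreeLT ι y (n + k)).comap (AddMonoidHom.mulRight (y ^ k)) from
    this hs
  refine degreeLT_le fun i hi r => ?_
  simpa [pow_add, mul_assoc] using
    map_mul_pow_mem_degreeLT (y := y) (ι := ι) (show i + k < n + k by omega) r

section Commutation

variable (hc : ∀ r, ∃ d, y * ι r = ι (σ r) * y + ι d)
include hc

theorem var_mul_mem_degreeLT {n : ℕ} {s : S} (hs : s ∈ degreeLT ι y n) :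
    y * s ∈ degreeLT ι y (n + 1) := by
  suffices degreeLT ι y n ≤ (degreeLT ι y (n + 1)).comap (AddMonoidHom.mulLeft y) from this hs
  refine degreeLT_le fun i hi r => ?_
  obtain ⟨d, hd⟩ := hc r
  have hyr : y * (ι r * y ^ i) = ι (σ r) * y ^ (i + 1) + ι d * y ^ i := by
    rw [← mul_assoc, hd, add_mul, mul_assoc, ← pow_succ']
  rw [AddSubgroup.mem_comap, AddMonoidHom.coe_mulLeft, hyr]
  exact add_mem (map_mul_pow_mem_degreeLT (by omega) _) (map_mul_pow_mem_degreeLT (by omega) _)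

theorem pow_mul_mem_degreeLT {n : ℕ} (k : ℕ) {s : S} (hs : s ∈ degreeLT ι y n) :
    y ^ k * s ∈ degreeLT ι y (n + k) := by
  induction k with
  | zero => simpa
  | succ k ih =>
    rw [pow_succ', mul_assoc]
    exact var_mul_mem_degreeLT hc ih

theorem pow_mul_map_sub_mem_degreeLT (n : ℕ) (r : R) :
    y ^ n * ι r - ι ((σ ^ n) r) * y ^ n ∈ degreeLT ι y n := by
  induction n with
  | zero => simp
  | succ n ih =>
    obtain ⟨d, hd⟩ := hc ((σ ^ n) r)
    have hstep : y ^ (n + 1) * ι r - ι ((σ ^ (n + 1)) r) * y ^ (n + 1)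
        = y * (y ^ n * ι r - ι ((σ ^ n) r) * y ^ n) + ι d * y ^ n := by
      rw [pow_succ' σ, RingAut.mul_apply, mul_sub, ← mul_assoc y (ι _), hd, pow_succ']
      noncomm_ring
    rw [hstep]
    exact add_mem (var_mul_mem_degreeLT hc ih) (map_mul_pow_mem_degreeLT n.lt_succ_self _)

theorem pow_mul_map_mem_degreeLT {i n : ℕ} (h : i < n) (r : R) :
    y ^ i * ι r ∈ degreeLT ι y n := by
  have hsub := degreeLT_mono h.le (pow_mul_map_sub_mem_degreeLT hc i r)
  simpa using add_mem hsub (map_mul_pow_mem_degreeLT h ((σ ^ i) r))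

theorem mul_map_mem_degreeLT {n : ℕ} (r : R) {s : S} (hs : s ∈ degreeLT ι y n) :
    s * ι r ∈ degreeLT ι y n := by
  suffices degreeLT ι y n ≤ (degreeLT ι y n).comap (AddMonoidHom.mulRight (ι r)) from this hs
  refine degreeLT_le fun i hi r' => ?_
  simpa [mul_assoc] using map_mul_mem_degreeLT r' (pow_mul_map_mem_degreeLT hc hi r)

theorem mul_mem_degreeLT {m n : ℕ} {s t : S} (hs : s ∈ degreeLT ι y m)
    (ht : t ∈ degreeLT ι y (n + 1)) : s * t ∈ degreeLT ι y (m + n) := by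
  suffices degreeLT ι y (n + 1) ≤ (degreeLT ι y (m + n)).comap (AddMonoidHom.mulLeft s) from
    this ht
  refine degreeLT_le fun i hi r => ?_
  simpa [mul_assoc] using degreeLT_mono (show m + i ≤ m + n by omega)
    (mul_pow_mem_degreeLT i (mul_map_mem_degreeLT hc r hs))

end Commutation

theorem symm_pow_apply_pow (σ : R ≃+* R) (n : ℕ) (r : R) : (σ.symm ^ n) ((σ ^ n) r) = r := by
  rw [show σ.symm = σ⁻¹ from rfl, inv_pow]
  exact (σ ^ n).symm_apply_apply r

/-- `s` has degree at most `n` in `y`, and `r` is its coefficient at `yⁿ`. The coefficient is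
written on the right, so that left multiplication by `y` does not change it. -/
def HasLead (ι : R →+* S) (y : S) (n : ℕ) (s : S) (r : R) : Prop :=
  s - y ^ n * ι r ∈ degreeLT ι y n

theorem hasLead_map (r : R) : HasLead ι y 0 (ι r) r := by
  simp [HasLead]

theorem hasLead_pow (n : ℕ) : HasLead ι y n (y ^ n) 1 := by
  simp [HasLead]

theorem hasLead_zero_iff {n : ℕ} {s : S} : HasLead ι y n s 0 ↔ s ∈ degreeLT ι y n := by
  simp [HasLead]

theorem HasLead.add {n : ℕ} {s t : S} {a b : R} (hs : HasLead ι y n s a)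
    (ht : HasLead ι y n t b) : HasLead ι y n (s + t) (a + b) := by
  have hst := add_mem hs ht
  rwa [← add_sub_add_comm, ← mul_add, ← map_add] at hst

theorem HasLead.sub {n : ℕ} {s t : S} {a b : R} (hs : HasLead ι y n s a)
    (ht : HasLead ι y n t b) : HasLead ι y n (s - t) (a - b) := by
  have hst := sub_mem hs ht
  rwa [sub_sub_sub_comm, ← mul_sub, ← map_sub] at hst

section LeadingCoefficient

variable (hc : ∀ r, ∃ d, y * ι r = ι (σ r) * y + ι d)
include hc

theorem hasLead_iff_sub_map_mul_pow_mem {n : ℕ} {s : S} {r : R} :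
    HasLead ι y n s r ↔ s - ι ((σ ^ n) r) * y ^ n ∈ degreeLT ι y n := by
  rw [HasLead, ← sub_add_sub_cancel s (y ^ n * ι r) (ι ((σ ^ n) r) * y ^ n),
    add_mem_cancel_right (pow_mul_map_sub_mem_degreeLT hc n r)]

theorem mem_degreeLT_succ_iff_exists_hasLead {n : ℕ} {s : S} :
    s ∈ degreeLT ι y (n + 1) ↔ ∃ r, HasLead ι y n s r := by
  simp only [mem_degreeLT_succ, hasLead_iff_sub_map_mul_pow_mem hc]
  exact (σ ^ n).surjective.exists

theorem HasLead.mul {m n : ℕ} {s t : S} {a b : R} (hs : HasLead ι y m s a)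
    (ht : HasLead ι y n t b) : HasLead ι y (m + n) (s * t) ((σ.symm ^ n) a * b) := by
  have hsplit : s * t - y ^ (m + n) * ι ((σ.symm ^ n) a * b)
      = (s - y ^ m * ι a) * t + y ^ m * (ι a * (t - y ^ n * ι b))
        + y ^ m * ((ι a * y ^ n - y ^ n * ι ((σ.symm ^ n) a)) * ι b) := by
    rw [map_mul, pow_add]
    noncomm_ring
  have hcomm : ι a * y ^ n - y ^ n * ι ((σ.symm ^ n) a) ∈ degreeLT ι y n := by
    have h := pow_mul_map_sub_mem_degreeLT hc n ((σ.symm ^ n) a)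
    rwa [show (σ ^ n) ((σ.symm ^ n) a) = a from symm_pow_apply_pow σ.symm n a,
      sub_mem_comm_iff] at h
  rw [HasLead, hsplit]
  refine add_mem (add_mem ?_ ?_) ?_
  · exact mul_mem_degreeLT hc hs ((mem_degreeLT_succ_iff_exists_hasLead hc).2 ⟨b, ht⟩)
  · rw [add_comm m n]
    exact pow_mul_mem_degreeLT hc m (map_mul_mem_degreeLT a ht)
  · rw [add_comm m n]
    exact pow_mul_mem_degreeLT hc m (mul_map_mem_degreeLT hc b hcomm)

theorem HasLead.map_mul {n : ℕ} {t : S} {b : R} (a : R) (ht : HasLead ι y n t b) :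
    HasLead ι y n (ι a * t) ((σ.symm ^ n) a * b) := by
  simpa using (hasLead_map a).mul hc ht

theorem HasLead.pow_mul {n : ℕ} {t : S} {b : R} (m : ℕ) (ht : HasLead ι y n t b) :
    HasLead ι y (m + n) (y ^ m * t) b := by
  simpa using (hasLead_pow m).mul hc ht

theorem op_mem_degreeLT_op {n : ℕ} {s : S} :
    op s ∈ degreeLT (RingHom.op ι) (op y) n ↔ s ∈ degreeLT ι y n := by
  induction n generalizing s with
  | zero => simp [mem_degreeLT_zero]
  | succ n ih =>
    rw [mem_degreeLT_succ_iff_exists_hasLead hc, mem_degreeLT_succ, op_surjective.exists]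
    refine exists_congr fun r => ?_
    rw [HasLead, ← ih]
    rfl

theorem exists_mem_degreeLT_of_adjoin_eq_top {K : Type*} [CommRing K] [Algebra K S] {X : Set S}
    (hX : Algebra.adjoin K X = ⊤) (hmem : ∀ x ∈ X, ∃ n, x ∈ degreeLT ι y n)
    (hK : ∀ k : K, algebraMap K S k ∈ Set.range ι) (s : S) : ∃ n, s ∈ degreeLT ι y n := by
  have hs : s ∈ Algebra.adjoin K X := hX ▸ Algebra.mem_top
  induction hs using Algebra.adjoin_induction with
  | mem x hx => exact hmem x hx
  | algebraMap k =>
    obtain ⟨r, hr⟩ := hK k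
    exact ⟨1, by simpa [hr] using map_mul_pow_mem_degreeLT (ι := ι) (y := y) zero_lt_one r⟩
  | add x z _ _ hx hz =>
    obtain ⟨m, hm⟩ := hx
    obtain ⟨n, hn⟩ := hz
    exact ⟨m + n, add_mem (degreeLT_mono (by omega) hm) (degreeLT_mono (by omega) hn)⟩
  | mul x z _ _ hx hz =>
    obtain ⟨m, hm⟩ := hx
    obtain ⟨n, hn⟩ := hz
    exact ⟨m + n, mul_mem_degreeLT hc hm (degreeLT_mono n.le_succ hn)⟩

end LeadingCoefficient

/-- `S` is the Ore extension `R[y; σ, δ]`, where `R` is embedded in `S` by `ι` and `σ` is an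
automorphism; the derivation is left implicit. -/
structure IsOreExtension (ι : R →+* S) (σ : R ≃+* R) (y : S) : Prop where
  comm : ∀ r, ∃ d, y * ι r = ι (σ r) * y + ι d
  uniq : ∀ n r, ι r * y ^ n ∈ degreeLT ι y n → r = 0
  exhaust : ∀ s, ∃ n, s ∈ degreeLT ι y n

theorem exists_automorphism
    (hL : ∀ r, ∃ r' d, y * ι r = ι r' * y + ι d)
    (hR : ∀ r, ∃ r' d, ι r * y = y * ι r' + ι d)
    (uL : ∀ r d, ι r * y = ι d → r = 0) (uR : ∀ r d, y * ι r = ι d → r = 0) :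
    ∃ σ : R ≃+* R, ∀ r, ∃ d, y * ι r = ι (σ r) * y + ι d := by
  choose f d hf using hL
  have huniq : ∀ r r' e, y * ι r = ι r' * y + ι e → f r = r' := by
    intro r r' e h
    refine sub_eq_zero.1 (uL _ (e - d r) ?_)
    rw [map_sub, map_sub, sub_mul, sub_eq_sub_iff_add_eq_add, ← hf, h, add_comm]
  let φ : R →+* R :=
    { toFun := f
      map_one' := huniq 1 1 0 (by simp)
      map_mul' := fun a b => huniq _ _ (f a * d b + d a * b) (by
        rw [map_mul, ← mul_assoc, hf a, add_mul, mul_assoc, hf b]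
        simp only [map_mul, map_add, mul_add, mul_assoc, add_assoc])
      map_zero' := huniq 0 0 0 (by simp)
      map_add' := fun a b => huniq _ _ (d a + d b) (by
        rw [map_add, mul_add, hf a, hf b]
        simp only [map_add, add_mul]
        abel) }
  have hinj : Function.Injective φ := by
    refine (injective_iff_map_eq_zero φ).2 fun r hr => uR r (d r) ?_
    rw [hf r, show f r = 0 from hr, map_zero, zero_mul, zero_add]
  have hsurj : Function.Surjective φ := fun r => by
    obtain ⟨r', e, h⟩ := hR r
    exact ⟨r', huniq r' r (-e) (by rw [h, map_neg, add_neg_cancel_right])⟩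
  exact ⟨RingEquiv.ofBijective φ ⟨hinj, hsurj⟩, fun r => ⟨d r, hf r⟩⟩

theorem exists_isOreExtension {K : Type*} [CommRing K] [Algebra K R] [Algebra K S]
    {ι : R →ₐ[K] S} (hgen : Algebra.adjoin K (insert y (Set.range ι)) = ⊤)
    (hL : ∀ r, ∃ r' d, y * ι r = ι r' * y + ι d)
    (hR : ∀ r, ∃ r' d, ι r * y = y * ι r' + ι d)
    (uL : ∀ n r, ι r * y ^ n ∈ degreeLT (ι : R →+* S) y n → r = 0)
    (uR : ∀ r d, y * ι r = ι d → r = 0) :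
    ∃ σ : R ≃+* R, IsOreExtension (ι : R →+* S) σ y := by
  have hmap : ∀ r, ι r ∈ degreeLT (ι : R →+* S) y 1 := fun r => by
    simpa using map_mul_pow_mem_degreeLT (ι := (ι : R →+* S)) (y := y) zero_lt_one r
  obtain ⟨σ, hσ⟩ := exists_automorphism (ι := (ι : R →+* S)) hL hR
    (fun r d h => uL 1 r (by rw [pow_one]; exact h ▸ hmap d)) uR
  refine ⟨σ, hσ, uL, exists_mem_degreeLT_of_adjoin_eq_top hσ hgen ?_ fun k =>
    ⟨algebraMap K R k, ι.commutes k⟩⟩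
  rintro x (rfl | ⟨r, rfl⟩)
  · exact ⟨2, by simpa using map_mul_pow_mem_degreeLT (ι := (ι : R →+* S)) (y := x) one_lt_two 1⟩
  · exact ⟨1, hmap r⟩

namespace IsOreExtension

variable (h : IsOreExtension ι σ y)
include h

theorem injective : Function.Injective ι :=
  (injective_iff_map_eq_zero ι).2 fun r hr => h.uniq 0 r (by simp [hr])

theorem hasLead_unique {n : ℕ} {s : S} {a b : R} (ha : HasLead ι y n s a)
    (hb : HasLead ι y n s b) : a = b := by
  have hab : HasLead ι y n 0 (a - b) := by simpa using ha.sub hb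
  rw [hasLead_iff_sub_map_mul_pow_mem h.comm, zero_sub, neg_mem_iff] at hab
  exact sub_eq_zero.1 ((map_eq_zero_iff _ (σ ^ n).injective).1 (h.uniq n _ hab))

theorem eq_zero_of_hasLead {n : ℕ} {s : S} {a : R} (hs : HasLead ι y n s a) (h0 : s = 0) :
    a = 0 :=
  h.hasLead_unique hs (hasLead_zero_iff.2 (h0 ▸ zero_mem _))

theorem exists_hasLead_ne_zero {s : S} (hs : s ≠ 0) : ∃ n r, r ≠ 0 ∧ HasLead ι y n s r := by
  obtain ⟨n, hn⟩ := h.exhaust s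
  induction n with
  | zero => exact absurd hn hs
  | succ n ih =>
    obtain ⟨r, hr⟩ := (mem_degreeLT_succ_iff_exists_hasLead h.comm).1 hn
    rcases eq_or_ne r 0 with rfl | h0
    · exact ih (hasLead_zero_iff.1 hr)
    · exact ⟨n, r, h0, hr⟩

theorem op : IsOreExtension (RingHom.op ι) (RingEquiv.op σ.symm) (op y) where
  comm r := by
    obtain ⟨d, hd⟩ := h.comm (σ.symm r.unop)
    rw [RingEquiv.apply_symm_apply] at hd
    exact ⟨MulOpposite.op (-d), unop_injective (by simp [hd])⟩
  uniq n r hr := by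
    have hmem : y ^ n * ι r.unop ∈ degreeLT ι y n := by
      rw [← op_mem_degreeLT_op h.comm]
      simpa using hr
    have hlead : HasLead ι y n 0 r.unop := by simpa [HasLead] using hmem
    exact unop_injective (h.eq_zero_of_hasLead hlead rfl)
  exhaust s := (h.exhaust s.unop).imp fun _ hn => (op_mem_degreeLT_op h.comm).2 hn

end IsOreExtension

end OreExtension

section SupIndep

variable {L : Type*} [Lattice L] [IsModularLattice L] [OrderBot L]

theorem supIndep_of_ascending {x a : ℕ → L} (ha : Monotone a) (hle : ∀ n, x n ≤ a (n + 1))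
    (hdisj : ∀ n, Disjoint (x n) (a n)) (s : Finset ℕ) : s.SupIndep x := by
  induction s using Finset.induction_on_max with
  | empty => exact Finset.supIndep_empty x
  | insert n s hs ih =>
    exact ih.insert ((hdisj n).mono_right (Finset.sup_le fun k hk => (hle k).trans (ha (hs k hk))))

theorem supIndep_of_descending {x a : ℕ → L} (ha : Antitone a) (hle : ∀ n, x n ≤ a n)
    (hdisj : ∀ n, Disjoint (x n) (a (n + 1))) (s : Finset ℕ) : s.SupIndep x := by
  induction s using Finset.induction_on_min with
  | empty => exact Finset.supIndep_empty x
  | insert n s hs ih =>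
    exact ih.insert ((hdisj n).mono_right (Finset.sup_le fun k hk => (hle k).trans (ha (hs k hk))))

theorem supIndep_sup_inf {ι : Type*} {s : Finset ι} {x : ι → L} {a b : L} (hs : s.SupIndep x)
    (hsa : Disjoint (s.sup x) a) (hab : Disjoint a b) :
    s.SupIndep fun i => (x i ⊔ a) ⊓ b := by
  intro t ht i hi hit
  have hxi : Disjoint (x i) (t.sup x ⊔ a) :=
    (hs ht hi hit).disjoint_sup_right_of_disjoint_sup_left
      (hsa.mono_left (sup_le (Finset.le_sup hi) (Finset.sup_mono ht)))
  have hinf : (a ⊔ x i) ⊓ (t.sup x ⊔ a) = a := by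
    rw [sup_inf_assoc_of_le _ le_sup_right, hxi.eq_bot, sup_bot_eq]
  refine disjoint_iff_inf_le.2 ((le_inf ?_ ?_).trans hab.le_bot)
  · refine (inf_le_inf (inf_le_left.trans (sup_comm _ _).le) (Finset.sup_le fun j hj => ?_)).trans
      hinf.le
    exact inf_le_left.trans (sup_le_sup_right (Finset.le_sup hj) a)
  · exact inf_le_left.trans inf_le_right

end SupIndep

theorem iSupIndep_restrictScalars {α S M : Type*} (R : Type*) [Ring R] [Ring S] [AddCommGroup M]
    [Module R M] [Module S M] [SMul R S] [IsScalarTower R S M] {I : α → Submodule S M}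
    (hI : iSupIndep I) : iSupIndep fun i => (I i).restrictScalars R := fun i => by
  simpa only [Submodule.disjoint_restrictScalars_iff, ← Submodule.restrictScalars_iSup] using hI i

section Rank

variable {L : Type*} [Lattice L] [OrderBot L]

/-- The uniform rank of `b` relative to `a` is at most `n`: every finite independent family of
nonzero elements below `b` whose join is disjoint from `a` has at most `n` members. -/
def RankLE (a b : L) (n : ℕ) : Prop :=
  ∀ (ι : Type) (s : Finset ι) (x : ι → L), (∀ i ∈ s, x i ≤ b) → (∀ i ∈ s, x i ≠ ⊥) →
    s.SupIndep x → Disjoint (s.sup x) a → s.card ≤ n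

theorem RankLE.of_essential {b c : L} {n : ℕ} (hb : RankLE ⊥ b n)
    (hess : ∀ x ≤ c, Disjoint x b → x = ⊥) : RankLE ⊥ c n := by
  intro ι s x hx hx0 hs _
  refine hb ι s (fun i => x i ⊓ b) (fun _ _ => inf_le_right) (fun i hi hbot => ?_)
    (hs.mono fun _ _ => inf_le_left) disjoint_bot_right
  exact hx0 i hi (hess _ (hx i hi) (disjoint_iff.2 hbot))

variable [IsModularLattice L]

theorem RankLE.add {a b : L} {m n : ℕ} (ha : RankLE ⊥ a m) (hab : RankLE a b n) :
    RankLE ⊥ b (m + n) := by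
  classical
  intro ι s x hx hx0 hs _
  obtain ⟨t, ht⟩ := (s.powerset.filter fun t => Disjoint (t.sup x) a).exists_maximal ⟨∅, by simp⟩
  obtain ⟨hts, hta⟩ : t ⊆ s ∧ Disjoint (t.sup x) a := by simpa using ht.prop
  have hw0 : ∀ i ∈ s \ t, (x i ⊔ t.sup x) ⊓ a ≠ ⊥ := by
    intro i hi hbot
    obtain ⟨his, hit⟩ := Finset.mem_sdiff.1 hi
    refine hit (ht.le_of_ge (y := insert i t) ?_ (Finset.subset_insert i t)
      (Finset.mem_insert_self i t))
    simpa [Finset.insert_subset_iff, his, hts] using disjoint_iff.2 hbot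
  have hw : (s \ t).SupIndep fun i => (x i ⊔ t.sup x) ⊓ a :=
    supIndep_sup_inf (hs.subset Finset.sdiff_subset)
      (hs.disjoint_sup_sup Finset.sdiff_subset hts Finset.sdiff_disjoint) hta
  have hcard_t : t.card ≤ n :=
    hab ι t x (fun i hi => hx i (hts hi)) (fun i hi => hx0 i (hts hi)) (hs.subset hts) hta
  have hcard_sdiff : (s \ t).card ≤ m :=
    ha ι (s \ t) _ (fun _ _ => inf_le_right) hw0 hw disjoint_bot_right
  rw [← Finset.card_sdiff_add_card_eq_card hts]
  exact add_le_add hcard_sdiff hcard_t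

theorem rankLE_of_chain {a : ℕ → L} {u : ℕ} (h0 : a 0 = ⊥)
    (h : ∀ n, RankLE (a n) (a (n + 1)) u) (n : ℕ) : RankLE ⊥ (a n) (n * u) := by
  induction n with
  | zero =>
    intro ι s x hx hx0 _ _
    by_contra hne
    obtain ⟨i, hi⟩ := Finset.card_pos.1 (by omega : 0 < s.card)
    exact hx0 i hi (le_bot_iff.1 (h0 ▸ hx i hi))
  | succ n ih => simpa only [add_mul, one_mul] using ih.add (h n)

theorem not_supIndep_of_chain {a : ℕ → L} {u : ℕ} (ha : Monotone a) (h0 : a 0 = ⊥)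
    (hu : ∀ n, RankLE (a n) (a (n + 1)) u) {b : Fin (u + 1) → L} {d : ℕ}
    (hb : ∀ i j, d ≤ j → ∃ x ≤ b i, x ≠ ⊥ ∧ x ≤ a (j + 1) ∧ Disjoint x (a j)) :
    ¬ Finset.univ.SupIndep b := by
  intro hindep
  choose x hxb hx0 hxa hdisj using fun i j => hb i (d + j) (Nat.le_add_right d j)
  let m := d * u + 1
  have hx : (Finset.univ.sigma fun _ => Finset.range m).SupIndep fun p => x p.1 p.2 :=
    Finset.SupIndep.sigma (hindep.mono fun i _ => Finset.sup_le fun j _ => hxb i j) fun i _ =>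
      supIndep_of_ascending (fun _ _ hjk => ha (Nat.add_le_add_left hjk d)) (hxa i) (hdisj i) _
  have hxle : ∀ p ∈ Finset.univ.sigma fun _ => Finset.range m, x p.1 p.2 ≤ a (d + m) := by
    rintro ⟨i, j⟩ hij
    have hjm : j < m := Finset.mem_range.1 (Finset.mem_sigma.1 hij).2
    exact (hxa i j).trans (ha (by omega))
  have hcard := rankLE_of_chain h0 hu (d + m) _ _ _ hxle (fun p _ => hx0 p.1 p.2) hx
    disjoint_bot_right
  simp only [Finset.card_sigma, Finset.sum_const, Finset.card_univ, Fintype.card_fin,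
    Finset.card_range, smul_eq_mul, m] at hcard
  linarith

theorem RankLE.sup_of_disjoint {a b : L} {n : ℕ} (hab : Disjoint a b) (hb : RankLE ⊥ b n) :
    RankLE a (a ⊔ b) n := by
  intro ι s x hx hx0 hs hsa
  refine hb ι s (fun i => (x i ⊔ a) ⊓ b) (fun _ _ => inf_le_right) (fun i hi hbot => ?_)
    (supIndep_sup_inf hs hsa hab) disjoint_bot_right
  have hxa : x i ≤ a :=
    calc x i ≤ (a ⊔ b) ⊓ (x i ⊔ a) := le_inf (hx i hi) le_sup_left
      _ = a ⊔ b ⊓ (x i ⊔ a) := sup_inf_assoc_of_le b le_sup_right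
      _ = a := by rw [inf_comm, hbot, sup_bot_eq]
  exact hx0 i hi ((hsa.mono_left (Finset.le_sup hi)).eq_bot_of_le hxa)

end Rank

section InfiniteRank

variable {L : Type*} [CompleteLattice L]

/-- There is no infinite independent sequence of nonzero elements. On the left ideals of a ring,
this is the second of the two left Goldie conditions. -/
def NoInfiniteIndep (L : Type*) [CompleteLattice L] : Prop :=
  ∀ x : ℕ → L, iSupIndep x → ∃ n, x n = ⊥

theorem noInfiniteIndep_of_wellFoundedGT [WellFoundedGT L] : NoInfiniteIndep L := by
  intro x hx
  by_contra! hne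
  exact Set.infinite_univ
    ((WellFoundedGT.finite_ne_bot_of_iSupIndep hx).subset fun n _ => hne n)

variable [IsModularLattice L] [IsCompactlyGenerated L]

theorem exists_disjoint_essential (a b : L) :
    ∃ c ≤ b, Disjoint a c ∧ ∀ x ≤ b, Disjoint x (a ⊔ c) → x = ⊥ := by
  obtain ⟨c, hc⟩ := zorn_le₀ {c : L | c ≤ b ∧ Disjoint a c} fun C hC hchain =>
    ⟨sSup C, ⟨sSup_le fun c hc => (hC hc).1,
      hchain.directedOn.disjoint_sSup_right.2 fun c hc => (hC hc).2⟩, fun c hc => le_sSup hc⟩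
  refine ⟨c, hc.prop.1, hc.prop.2, fun x hx hdisj => ?_⟩
  have hxc : x ≤ c := le_sup_right.trans (hc.le_of_ge (y := c ⊔ x)
    ⟨sup_le hc.prop.1 hx, hc.prop.2.disjoint_sup_right_of_disjoint_sup_left hdisj.symm⟩
    le_sup_left)
  exact hdisj.eq_bot_of_le (hxc.trans le_sup_right)

theorem exists_split_of_infinite_rank {b : L} (hb : ¬ ∃ n, RankLE ⊥ b n) :
    ∃ x ≤ b, ∃ c ≤ b, x ≠ ⊥ ∧ Disjoint x c ∧ ¬ ∃ n, RankLE ⊥ c n := by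
  obtain ⟨x, hxb, hx0, y, hyb, hy0, hxy⟩ :
      ∃ x ≤ b, x ≠ ⊥ ∧ ∃ y ≤ b, y ≠ ⊥ ∧ Disjoint x y := by
    have hb1 : ¬ RankLE ⊥ b 1 := fun h => hb ⟨1, h⟩
    simp only [RankLE] at hb1
    push Not at hb1
    obtain ⟨ι, s, x, hx, hx0, hs, -, hcard⟩ := hb1
    obtain ⟨i, hi, j, hj, hij⟩ := Finset.one_lt_card.1 hcard
    exact ⟨x i, hx i hi, hx0 i hi, x j, hx j hj, hx0 j hj, hs.pairwiseDisjoint hi hj hij⟩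
  obtain ⟨c, hcb, hxc, hess⟩ := exists_disjoint_essential x b
  by_cases hx : ∃ m, RankLE ⊥ x m
  · refine ⟨x, hxb, c, hcb, hx0, hxc, ?_⟩
    rintro ⟨n, hn⟩
    obtain ⟨m, hm⟩ := hx
    exact hb ⟨m + n, (hm.add (hn.sup_of_disjoint hxc)).of_essential hess⟩
  · exact ⟨y, hyb, x, hxb, hy0, hxy.symm, hx⟩

theorem NoInfiniteIndep.exists_rankLE (h : NoInfiniteIndep L) : ∃ n, RankLE (⊥ : L) ⊤ n := by
  by_contra hinf
  let T := {b : L // ¬ ∃ n, RankLE ⊥ b n}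
  choose x hx c hcb hx0 hxc hc using fun b : T => exists_split_of_infinite_rank b.2
  let b : ℕ → T := fun n => Nat.rec ⟨⊤, hinf⟩ (fun _ b => ⟨c b, hc b⟩) n
  have hanti : Antitone fun n => (b n).1 := antitone_nat_of_succ_le fun n => hcb (b n)
  have hindep : iSupIndep fun n => x (b n) := iSupIndep_iff_supIndep.2
    (supIndep_of_descending hanti (fun n => hx (b n)) fun n => hxc (b n))
  obtain ⟨n, hn⟩ := h _ hindep
  exact hx0 _ hn

end InfiniteRank

section SemiprimeRing

variable {R : Type*} [Ring R]

theorem IsSemiprimeRing.op (h : IsSemiprimeRing R) : IsSemiprimeRing Rᵐᵒᵖ := fun a ha =>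
  unop_injective (h a.unop fun r => by
    simpa [mul_assoc] using congrArg unop (ha (MulOpposite.op r)))

theorem IsSemiprimeRing.of_op (h : IsSemiprimeRing Rᵐᵒᵖ) : IsSemiprimeRing R := fun a ha =>
  op_injective (h (MulOpposite.op a) fun r => unop_injective (by simpa [mul_assoc] using ha r.unop))

theorem IsSemiprimeRing.mul_mul_eq_zero_symm (hR : IsSemiprimeRing R) {a b : R}
    (hab : ∀ r, a * r * b = 0) (r : R) : b * r * a = 0 := by
  refine hR _ fun t => ?_
  calc b * r * a * t * (b * r * a) = b * r * (a * t * b) * (r * a) := by noncomm_ring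
    _ = 0 := by rw [hab, mul_zero, zero_mul]

theorem IsSemiprimeRing.iSupIndep_span_singleton (hR : IsSemiprimeRing R) {α : Type*} {a : α → R}
    (ha : ∀ i j, i ≠ j → ∀ r, a i * r * a j = 0) : iSupIndep fun i => Ideal.span {a i} := by
  rw [iSupIndep_def]
  refine fun i => Submodule.disjoint_def.2 fun x hx hx' => hR x fun t => ?_
  have hle : ⨆ (j) (_ : j ≠ i), Ideal.span {a j} ≤ leftAnnihilator (Set.range (· * a i)) := by
    refine iSup₂_le fun j hj => (Ideal.span_singleton_le_iff_mem _).2 ?_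
    rintro _ ⟨r, rfl⟩
    rw [← mul_assoc, ha j i hj]
  obtain ⟨c, rfl⟩ := Ideal.mem_span_singleton'.1 hx
  simpa only [mul_assoc] using hle hx' _ ⟨t * c, rfl⟩

end SemiprimeRing

section Nonsingular

/-- The left singular ideal of `R` is zero: no nonzero element of `R` has an essential left
annihilator. Essentiality is expressed on elements. -/
def IsLeftNonsingular (R : Type*) [Ring R] : Prop :=
  ∀ a : R, (∀ r : R, r ≠ 0 → ∃ t : R, t * r ≠ 0 ∧ t * r * a = 0) → a = 0

variable {R : Type*} [Ring R]

theorem IsSemiprimeRing.isLeftNonsingular (hR : IsSemiprimeRing R)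
    (hacc : WellFoundedGT (Set.range (leftAnnihilator : Set R → Ideal R))) :
    IsLeftNonsingular R := by
  by_contra hne
  simp only [IsLeftNonsingular, not_forall] at hne
  obtain ⟨a₀, ha₀, ha₀0⟩ := hne
  let ann : R → Set.range (leftAnnihilator : Set R → Ideal R) :=
    fun a => ⟨leftAnnihilator {a}, _, rfl⟩
  obtain ⟨a, ⟨ha0, ha⟩, hmax⟩ := (InvImage.wf ann hacc.wf).has_min
    {a : R | a ≠ 0 ∧ ∀ r : R, r ≠ 0 → ∃ t : R, t * r ≠ 0 ∧ t * r * a = 0} ⟨a₀, ha₀0, ha₀⟩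
  refine ha0 (hR a fun r => ?_)
  by_contra hara
  obtain ⟨t, ht, hta⟩ := ha (a * r) fun har => hara (by rw [har, zero_mul])
  have hle : leftAnnihilator {a} ≤ leftAnnihilator {a * r * a} := by
    rintro x hx _ rfl
    rw [mul_assoc a, ← mul_assoc, hx a rfl, zero_mul]
  have ht_mem : t ∈ leftAnnihilator {a * r * a} := by
    rintro _ rfl
    rw [← mul_assoc, hta]
  refine hmax (a * r * a) ⟨hara, fun s hs => ?_⟩ (hle.lt_of_not_ge fun hge => ?_)
  · obtain ⟨t, ht, hta⟩ := ha s hs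
    exact ⟨t, ht, by rw [mul_assoc a, ← mul_assoc, hta, zero_mul]⟩
  · exact ht (by rw [← mul_assoc, hge ht_mem a rfl, zero_mul])

theorem IsLeftNonsingular.exists_disjoint_span_singleton (hR : IsLeftNonsingular R) {T : Set R}
    {I : Ideal R} (hI : leftAnnihilator T < I) :
    ∃ v ∈ I, v ≠ 0 ∧ Disjoint (Ideal.span {v}) (leftAnnihilator T) := by
  by_contra! hess
  obtain ⟨b, hbI, hb⟩ := SetLike.exists_of_lt hI
  refine hb fun s hs => hR _ fun r hr => ?_
  by_cases hrb : r * b = 0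
  · exact ⟨1, by rwa [one_mul], by rw [one_mul, ← mul_assoc, hrb, zero_mul]⟩
  · have hmeet := hess (r * b) (I.mul_mem_left r hbI) hrb
    simp only [Submodule.disjoint_def, Ideal.mem_span_singleton'] at hmeet
    push Not at hmeet
    obtain ⟨_, ⟨t, rfl⟩, htT, ht0⟩ := hmeet
    refine ⟨t, fun h0 => ht0 (by rw [← mul_assoc, h0, zero_mul]), ?_⟩
    simpa only [mul_assoc] using htT s hs

theorem IsLeftNonsingular.wellFoundedGT_leftAnnihilator (hR : IsLeftNonsingular R)
    (hfin : NoInfiniteIndep (Ideal R)) :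
    WellFoundedGT (Set.range (leftAnnihilator : Set R → Ideal R)) := by
  refine ⟨RelEmbedding.wellFounded_iff_isEmpty.2 ⟨fun f => ?_⟩⟩
  have hlt : ∀ n, (f n).1 < (f (n + 1)).1 := fun n => f.map_rel_iff.2 n.lt_succ_self
  have hex : ∀ n, ∃ v ∈ (f (n + 1)).1, v ≠ 0 ∧ Disjoint (Ideal.span {v}) (f n).1 := fun n => by
    obtain ⟨T, hT⟩ := (f n).2
    rw [← hT]
    exact hR.exists_disjoint_span_singleton (hT ▸ hlt n)
  choose v hv hv0 hdisj using hex
  obtain ⟨n, hn⟩ := hfin (fun n => Ideal.span {v n}) (iSupIndep_iff_supIndep.2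
    (supIndep_of_ascending (monotone_nat_of_le_succ fun n => (hlt n).le)
      (fun n => (Ideal.span_singleton_le_iff_mem _).2 (hv n)) hdisj))
  exact hv0 n (Ideal.span_singleton_eq_bot.1 hn)

end Nonsingular

namespace IsOreExtension

variable {R S : Type*} [Ring R] [Ring S] {ι : R →+* S} {y : S} {σ : R ≃+* R}

section Elementwise

variable (h : IsOreExtension ι σ y)
include h

theorem isDomain (hR : IsDomain R) : IsDomain S := by
  have : Nontrivial S := h.injective.nontrivial
  have : NoZeroDivisors S := by
    refine ⟨fun {s t} hst => ?_⟩
    by_contra! hne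
    obtain ⟨m, a, ha, hs⟩ := h.exists_hasLead_ne_zero hne.1
    obtain ⟨n, b, hb, ht⟩ := h.exists_hasLead_ne_zero hne.2
    rcases mul_eq_zero.1 (h.eq_zero_of_hasLead (hs.mul h.comm ht) hst) with ha0 | hb0
    · exact ha ((map_eq_zero_iff _ (σ.symm ^ n).injective).1 ha0)
    · exact hb hb0
  exact NoZeroDivisors.to_isDomain S

theorem mul_mul_eq_zero_of_hasLead {m n k : ℕ} {s t : S} {a b : R} (hs : HasLead ι y m s a)
    (ht : HasLead ι y n t b) (hst : ∀ q, s * q * t = 0) (r : R) :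
    (σ.symm ^ (n + k)) a * r * b = 0 := by
  have hlead := (hs.mul h.comm
    ((hasLead_pow k).mul h.comm (hasLead_map ((σ ^ n) r)))).mul h.comm ht
  have hzero := h.eq_zero_of_hasLead hlead (hst _)
  rwa [map_one, one_mul, add_zero, map_mul, symm_pow_apply_pow, ← RingAut.mul_apply,
    ← pow_add] at hzero

theorem isPrimeRing (hR : IsPrimeRing R) : IsPrimeRing S := by
  have : Nontrivial R := hR.1
  refine ⟨h.injective.nontrivial, fun s t hst => ?_⟩
  by_contra! hne
  obtain ⟨m, a, ha, hs⟩ := h.exists_hasLead_ne_zero hne.1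
  obtain ⟨n, b, hb, ht⟩ := h.exists_hasLead_ne_zero hne.2
  rcases hR.2 _ _ (h.mul_mul_eq_zero_of_hasLead (k := 0) hs ht hst) with ha0 | hb0
  · exact ha ((map_eq_zero_iff _ (σ.symm ^ n).injective).1 ha0)
  · exact hb hb0

theorem isSemiprimeRing (hR : IsSemiprimeRing R) (hfin : NoInfiniteIndep (Ideal R)) :
    IsSemiprimeRing S := by
  intro f hf
  by_contra hne
  obtain ⟨n, a, ha, hlead⟩ := h.exists_hasLead_ne_zero hne
  let b : ℕ → R := fun i => (σ.symm ^ ((n + 1) * i)) a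
  have hlt : ∀ i j, j < i → ∀ r, b i * r * b j = 0 := by
    intro i j hij r
    obtain ⟨k, rfl⟩ : ∃ k, i = j + 1 + k := ⟨i - (j + 1), by omega⟩
    have hshift := congrArg (σ.symm ^ ((n + 1) * j)) (h.mul_mul_eq_zero_of_hasLead
      (k := 1 + (n + 1) * k) hlead hlead hf ((σ ^ ((n + 1) * j)) r))
    rw [map_mul, map_mul, symm_pow_apply_pow, map_zero, ← RingAut.mul_apply, ← pow_add] at hshift
    simpa only [b, show (n + 1) * (j + 1 + k) = (n + 1) * j + (n + (1 + (n + 1) * k)) by ring]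
      using hshift
  have horth : ∀ i j, i ≠ j → ∀ r, b i * r * b j = 0 := fun i j hij =>
    hij.lt_or_gt.elim (fun hlt' => hR.mul_mul_eq_zero_symm (hlt j i hlt')) (hlt i j)
  obtain ⟨m, hm⟩ := hfin _ (hR.iSupIndep_span_singleton horth)
  exact ha ((map_eq_zero_iff _ (σ.symm ^ ((n + 1) * m)).injective).1
    (Ideal.span_singleton_eq_bot.1 hm))

theorem exists_hasLead_mul_map {s : S} {r : R} (hs : s * ι r ≠ 0) :
    ∃ n c, c * r ≠ 0 ∧ HasLead ι y n (s * ι r) (c * r) := by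
  obtain ⟨n, hn⟩ := h.exhaust s
  induction n generalizing s with
  | zero => exact absurd (by rw [mem_degreeLT_zero.1 hn, zero_mul]) hs
  | succ n ih =>
    obtain ⟨c, hc⟩ := (mem_degreeLT_succ_iff_exists_hasLead h.comm).1 hn
    by_cases h0 : c * r = 0
    · have htail : s * ι r = (s - y ^ n * ι c) * ι r := by
        rw [sub_mul, mul_assoc (y ^ n), ← map_mul, h0, map_zero, mul_zero, sub_zero]
      rw [htail] at hs ⊢
      exact ih hs hc
    · exact ⟨n, c, h0, by simpa using hc.mul h.comm (hasLead_map r)⟩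

theorem isLeftNonsingular (hR : IsLeftNonsingular R) : IsLeftNonsingular S := by
  intro f hf
  by_contra hne
  obtain ⟨n, a, ha, hlead⟩ := h.exists_hasLead_ne_zero hne
  refine ha (hR a fun r hr => ?_)
  have hr' : ι ((σ ^ n) r) ≠ 0 := by
    rwa [Ne, map_eq_zero_iff ι h.injective, map_eq_zero_iff _ (σ ^ n).injective]
  obtain ⟨t, ht, htf⟩ := hf _ hr'
  obtain ⟨m, c, hc, hct⟩ := h.exists_hasLead_mul_map ht
  have hzero := h.eq_zero_of_hasLead (hct.mul h.comm hlead) htf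
  rw [map_mul, symm_pow_apply_pow] at hzero
  refine ⟨(σ.symm ^ n) c, fun h0 => hc ?_, hzero⟩
  rw [← map_eq_zero_iff _ (σ.symm ^ n).injective, map_mul, symm_pow_apply_pow, h0]

end Elementwise

section LeadIdeal

variable [Module R S] (hι : ∀ (r : R) (s : S), r • s = ι r * s)

/-- The polynomials of degree less than `n`, as a left module over the coefficients. -/
def degreeSubmodule (y : S) (n : ℕ) : Submodule R S :=
  { degreeLT ι y n with
    smul_mem' := fun r s hs => by
      rw [hι]
      exact map_mul_mem_degreeLT r hs }

/-- The left ideal formed by the coefficients at `yⁿ` of the elements of `X` that have degree at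
most `n`. -/
def leadIdeal (h : IsOreExtension ι σ y) (X : Submodule R S) (n : ℕ) : Ideal R where
  carrier := {r | ∃ s ∈ X, HasLead ι y n s r}
  add_mem' := by
    rintro a b ⟨s, hs, ha⟩ ⟨t, ht, hb⟩
    exact ⟨s + t, add_mem hs ht, ha.add hb⟩
  zero_mem' := ⟨0, zero_mem _, hasLead_zero_iff.2 (zero_mem _)⟩
  smul_mem' := by
    rintro c a ⟨s, hs, ha⟩
    refine ⟨(σ ^ n) c • s, X.smul_mem _ hs, ?_⟩
    simpa only [hι, smul_eq_mul, symm_pow_apply_pow] using ha.map_mul h.comm ((σ ^ n) c)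

variable (h : IsOreExtension ι σ y)
include h

theorem leadIdeal_mono (n : ℕ) : Monotone fun X => h.leadIdeal hι X n := by
  rintro X Y hXY r ⟨s, hs, hr⟩
  exact ⟨s, hXY hs, hr⟩

theorem leadIdeal_mono_degree {X : Submodule R S} (hX : ∀ s ∈ X, y * s ∈ X) :
    Monotone (h.leadIdeal hι X) := by
  refine monotone_nat_of_le_succ fun n => ?_
  rintro r ⟨s, hs, hr⟩
  exact ⟨y * s, hX s hs, by simpa [add_comm] using hr.pow_mul h.comm 1⟩

theorem eq_of_le_of_leadIdeal_le {X Y : Submodule R S} (hXY : X ≤ Y)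
    (hle : ∀ n, h.leadIdeal hι Y n ≤ h.leadIdeal hι X n) : X = Y := by
  refine hXY.antisymm fun s hs => ?_
  obtain ⟨n, hn⟩ := h.exhaust s
  induction n generalizing s with
  | zero => exact mem_degreeLT_zero.1 hn ▸ zero_mem _
  | succ n ih =>
    obtain ⟨r, hr⟩ := (mem_degreeLT_succ_iff_exists_hasLead h.comm).1 hn
    obtain ⟨t, ht, htr⟩ := hle n ⟨s, hs, hr⟩
    have hdrop : s - t ∈ degreeLT ι y n := by
      simpa [hasLead_zero_iff] using hr.sub htr
    exact sub_add_cancel s t ▸ add_mem (ih (s - t) (sub_mem hs (hXY ht)) hdrop) ht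

theorem leadIdeal_ne_bot {X : Submodule R S} {n : ℕ} (hX : X ≤ degreeSubmodule hι y (n + 1))
    (h0 : X ≠ ⊥) (hdisj : Disjoint X (degreeSubmodule hι y n)) : h.leadIdeal hι X n ≠ ⊥ := by
  obtain ⟨s, hs, hs0⟩ := X.ne_bot_iff.1 h0
  obtain ⟨r, hr⟩ := (mem_degreeLT_succ_iff_exists_hasLead h.comm).1 (hX hs)
  refine (Submodule.ne_bot_iff _).2 ⟨r, ⟨s, hs, hr⟩, ?_⟩
  rintro rfl
  exact hs0 (Submodule.disjoint_def.1 hdisj s hs (hasLead_zero_iff.1 hr))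

theorem disjoint_leadIdeal {X Y : Submodule R S} {n : ℕ} (hXY : Disjoint X Y)
    (hdisj : Disjoint (X ⊔ Y) (degreeSubmodule hι y n)) :
    Disjoint (h.leadIdeal hι X n) (h.leadIdeal hι Y n) := by
  refine Submodule.disjoint_def.2 ?_
  rintro r ⟨s, hs, hsr⟩ ⟨t, ht, htr⟩
  have hst : s - t ∈ degreeSubmodule hι y n := hasLead_zero_iff.1 (by simpa using hsr.sub htr)
  have heq : s = t := sub_eq_zero.1 (Submodule.disjoint_def.1 hdisj _
    (sub_mem (Submodule.mem_sup_left hs) (Submodule.mem_sup_right ht)) hst)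
  exact h.eq_zero_of_hasLead hsr (Submodule.disjoint_def.1 hXY s hs (heq ▸ ht))

theorem rankLE_degreeSubmodule {u : ℕ} (hu : RankLE (⊥ : Ideal R) ⊤ u) (n : ℕ) :
    RankLE (degreeSubmodule hι y n) (degreeSubmodule hι y (n + 1)) u := by
  intro α s X hX hX0 hindep hdisj
  refine hu α s (fun i => h.leadIdeal hι (X i) n) (fun _ _ => le_top)
    (fun i hi => h.leadIdeal_ne_bot hι (hX i hi) (hX0 i hi)
      (hdisj.mono_left (Finset.le_sup hi))) (fun t ht i hi hit => ?_) disjoint_bot_right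
  have hlead := h.disjoint_leadIdeal hι (hindep ht hi hit)
    (hdisj.mono_left (sup_le (Finset.le_sup hi) (Finset.sup_mono ht)))
  exact hlead.mono_right (Finset.sup_le fun j hj => h.leadIdeal_mono hι n (Finset.le_sup hj))

/-- The multiplier is `ι (σʲ r) yʲ⁻ᵈ`, where `R r` meets the left annihilator of `a` trivially. -/
theorem exists_mul_disjoint_degreeSubmodule (hR : IsLeftNonsingular R) {f : S} {d j : ℕ} {a : R}
    (ha : a ≠ 0) (hf : HasLead ι y d f a) (hdj : d ≤ j) :
    ∃ s : S, s * f ≠ 0 ∧ s * f ∈ degreeSubmodule hι y (j + 1) ∧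
      Disjoint (Submodule.span R {s * f}) (degreeSubmodule hι y j) := by
  obtain ⟨r, hr, hra⟩ : ∃ r, r ≠ 0 ∧ ∀ t, t * r ≠ 0 → t * r * a ≠ 0 := by
    simpa using mt (hR a) ha
  have hlead : HasLead ι y j (ι ((σ ^ j) r) * y ^ (j - d) * f) (r * a) := by
    have hpow := hf.pow_mul h.comm (j - d)
    rw [Nat.sub_add_cancel hdj] at hpow
    simpa only [symm_pow_apply_pow, ← mul_assoc] using hpow.map_mul h.comm ((σ ^ j) r)
  refine ⟨ι ((σ ^ j) r) * y ^ (j - d), fun h0 => ?_,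
    (mem_degreeLT_succ_iff_exists_hasLead h.comm).2 ⟨_, hlead⟩,
    (Submodule.disjoint_span_singleton''.2 fun c hc => ?_).symm⟩
  · exact hra 1 (by rwa [one_mul]) (by rw [one_mul, h.eq_zero_of_hasLead hlead h0])
  · rw [hι] at hc ⊢
    have hzero := h.hasLead_unique (hlead.map_mul h.comm c) (hasLead_zero_iff.2 hc)
    rw [← mul_assoc] at hzero
    have hcr : (σ.symm ^ j) (c * (σ ^ j) r) = 0 := by
      rw [map_mul, symm_pow_apply_pow]
      exact not_imp_not.1 (hra _) hzero
    rw [map_eq_zero_iff _ (σ.symm ^ j).injective] at hcr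
    rw [← mul_assoc, ← mul_assoc, ← map_mul, hcr, map_zero, zero_mul, zero_mul]

end LeadIdeal

variable (h : IsOreExtension ι σ y)
include h

theorem isNoetherianRing (hR : IsNoetherianRing R) : IsNoetherianRing S := by
  let _ : Module R S := Module.compHom S ι
  have : IsScalarTower R S S := ⟨fun r s t => mul_assoc (ι r) s t⟩
  have hι : ∀ (r : R) (s : S), r • s = ι r * s := fun _ _ => rfl
  rw [isNoetherianRing_iff, ← monotone_stabilizes_iff_noetherian] at hR ⊢
  intro L
  let lead : ℕ → ℕ → Ideal R := fun k => h.leadIdeal hι ((L k).restrictScalars R)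
  have hlead_mono : ∀ {k k' n n'}, k ≤ k' → n ≤ n' → lead k n ≤ lead k' n' := fun hk hn =>
    (h.leadIdeal_mono hι _ (L.monotone hk)).trans
      (h.leadIdeal_mono_degree hι (fun _ hs => (L _).smul_mem y hs) hn)
  obtain ⟨N, hN⟩ := hR ⟨fun k => lead k k, fun _ _ hk => hlead_mono hk hk⟩
  choose M hM using fun n => hR ⟨fun k => lead k n, fun _ _ hk => hlead_mono hk le_rfl⟩
  let T := max N ((Finset.range N).sup M)
  refine ⟨T, fun k hk => Submodule.restrictScalars_injective R S S
    (h.eq_of_le_of_leadIdeal_le hι (L.monotone hk) fun n => ?_)⟩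
  change lead k n ≤ lead T n
  rcases lt_or_ge n N with hn | hn
  · have hMT : M n ≤ T := (Finset.le_sup (Finset.mem_range.2 hn)).trans (le_max_right _ _)
    calc lead k n = lead (M n) n := (hM n k (hMT.trans hk)).symm
      _ ≤ lead T n := hlead_mono hMT le_rfl
  · calc lead k n ≤ lead (max k n) (max k n) := hlead_mono (le_max_left _ _) (le_max_right _ _)
      _ = lead N N := (hN _ (hn.trans (le_max_right _ _))).symm
      _ ≤ lead T n := hlead_mono (le_max_left _ _) hn

theorem noInfiniteIndep (hR : IsLeftNonsingular R) (hfin : NoInfiniteIndep (Ideal R)) :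
    NoInfiniteIndep (Ideal S) := by
  let _ : Module R S := Module.compHom S ι
  have : IsScalarTower R S S := ⟨fun r s t => mul_assoc (ι r) s t⟩
  have hι : ∀ (r : R) (s : S), r • s = ι r * s := fun _ _ => rfl
  obtain ⟨u, hu⟩ := hfin.exists_rankLE
  intro I hI
  by_contra! hne
  choose f hfI hf0 using fun n => (I n).ne_bot_iff.1 (hne n)
  choose d a ha hlead using fun n => h.exists_hasLead_ne_zero (hf0 n)
  let b : Fin (u + 1) → Submodule R S := fun i => (I i).restrictScalars R
  refine not_supIndep_of_chain (a := degreeSubmodule hι y) (b := b) degreeLT_mono rfl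
    (h.rankLE_degreeSubmodule hι hu) (d := Finset.univ.sup fun i : Fin (u + 1) => d i)
    (fun i j hj => ?_)
    (((iSupIndep_restrictScalars R hI).comp Fin.val_injective).supIndep' Finset.univ)
  obtain ⟨s, hs0, hs, hdisj⟩ := h.exists_mul_disjoint_degreeSubmodule hι hR (ha i) (hlead i)
    ((Finset.le_sup (f := fun i : Fin (u + 1) => d i) (Finset.mem_univ i)).trans hj)
  exact ⟨Submodule.span R {s * f i},
    (Submodule.span_singleton_le_iff_mem _ _).2 ((I i).mul_mem_left s (hfI i)),
    Submodule.span_singleton_eq_bot.not.2 hs0,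
    (Submodule.span_singleton_le_iff_mem _ _).2 hs, hdisj⟩

theorem isLeftGoldie (hR : IsSemiprimeRing R) (hG : IsLeftGoldie R) : IsLeftGoldie S := by
  have hns := hR.isLeftNonsingular hG.acc_annihilators
  have hfin := h.noInfiniteIndep hns hG.no_infinite_direct_sum
  exact ⟨(h.isLeftNonsingular hns).wellFoundedGT_leftAnnihilator hfin, hfin⟩

end IsOreExtension

/-- Each of the eight ring properties under consideration passes from `R` to `S`. -/
def TransfersTo (R S : Type*) [Ring R] [Ring S] : Prop :=
  (IsLeftNoetherian R → IsLeftNoetherian S) ∧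
  (IsRightNoetherian R → IsRightNoetherian S) ∧
  (IsDomain R → IsDomain S) ∧
  (IsPrimeRing R → IsPrimeRing S) ∧
  (IsSemiprimeRing R ∧ IsLeftNoetherian R → IsSemiprimeRing S ∧ IsLeftNoetherian S) ∧
  (IsSemiprimeRing R ∧ IsRightNoetherian R → IsSemiprimeRing S ∧ IsRightNoetherian S) ∧
  (IsSemiprimeRing R ∧ IsLeftGoldie R → IsSemiprimeRing S ∧ IsLeftGoldie S) ∧
  (IsSemiprimeRing R ∧ IsRightGoldie R → IsSemiprimeRing S ∧ IsRightGoldie S)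

theorem TransfersTo.trans {R S T : Type*} [Ring R] [Ring S] [Ring T] (hRS : TransfersTo R S)
    (hST : TransfersTo S T) : TransfersTo R T := by
  obtain ⟨a, b, c, d, e, f, g, i⟩ := hRS
  obtain ⟨a', b', c', d', e', f', g', i'⟩ := hST
  exact ⟨a' ∘ a, b' ∘ b, c' ∘ c, d' ∘ d, e' ∘ e, f' ∘ f, g' ∘ g, i' ∘ i⟩

theorem IsOreExtension.transfersTo {R S : Type*} [Ring R] [Ring S] {ι : R →+* S} {σ : R ≃+* R}
    {y : S} (h : IsOreExtension ι σ y) : TransfersTo R S := by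
  refine ⟨h.isNoetherianRing, h.op.isNoetherianRing, h.isDomain, h.isPrimeRing, ?_, ?_, ?_, ?_⟩
  · rintro ⟨hs, hn⟩
    have : IsNoetherianRing R := hn
    exact ⟨h.isSemiprimeRing hs noInfiniteIndep_of_wellFoundedGT, h.isNoetherianRing hn⟩
  · rintro ⟨hs, hn⟩
    have : IsNoetherianRing Rᵐᵒᵖ := hn
    exact ⟨(h.op.isSemiprimeRing hs.op noInfiniteIndep_of_wellFoundedGT).of_op,
      h.op.isNoetherianRing hn⟩
  · rintro ⟨hs, hg⟩
    exact ⟨h.isSemiprimeRing hs hg.no_infinite_direct_sum, h.isLeftGoldie hs hg⟩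
  · rintro ⟨hs, hg⟩
    exact ⟨(h.op.isSemiprimeRing hs.op (IsLeftGoldie.no_infinite_direct_sum hg)).of_op,
      h.op.isLeftGoldie hs.op hg⟩

section Triangular

variable {R M ι : Type*} [Ring R] [AddCommGroup M] [Module R M] {b w : ι → M}
  {d : ι → ℕ} {c : ι → Rˣ}

theorem linearIndependent_of_triangular (hb : LinearIndependent R b)
    (hw : ∀ i, w i - c i • b i ∈ Submodule.span R (b '' {j | d j < d i})) :
    LinearIndependent R w := by
  classical
  rw [linearIndependent_iff]
  intro f hf
  by_contra hne
  obtain ⟨i, hi, hmax⟩ := f.support.exists_max_image d (Finsupp.support_nonempty_iff.2 hne)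
  let N := Submodule.span R (b '' (Set.univ \ {i}))
  have hlow (j : ι) (hj : j ∈ f.support) : w j - c j • b j ∈ N := by
    have hsub : {k | d k < d j} ⊆ Set.univ \ {i} := fun k hk => ⟨trivial, fun h => by
      obtain rfl : k = i := h
      exact (hmax j hj).not_gt hk⟩
    exact Submodule.span_mono (Set.image_mono hsub) (hw j)
  have hrest : ∑ j ∈ f.support.erase i, f j • w j ∈ N := N.sum_mem fun j hj => by
    obtain ⟨hji, hj⟩ := Finset.mem_erase.1 hj
    have hbj : b j ∈ N := Submodule.subset_span (Set.mem_image_of_mem b ⟨trivial, hji⟩)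
    exact N.smul_mem _ ((N.sub_mem_iff_left (N.smul_mem (c j : R) hbj)).1 (hlow j hj))
  have hsum : f i • w i + ∑ j ∈ f.support.erase i, f j • w j = 0 :=
    (Finset.add_sum_erase _ _ hi).trans hf
  have hlead : (f i * c i) • b i ∈ N := by
    have : (f i * c i) • b i
        = -(f i • (w i - c i • b i)) - ∑ j ∈ f.support.erase i, f j • w j := by
      rw [smul_sub, eq_neg_of_add_eq_zero_left hsum, mul_smul, Units.smul_def]
      abel
    rw [this]
    exact N.sub_mem (N.neg_mem (N.smul_mem _ (hlow i hi))) hrest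
  have := linearIndependent_iff_eq_zero_of_smul_mem_span.1 hb i _ hlead
  exact Finsupp.mem_support_iff.1 hi ((c i).mul_left_eq_zero.1 this)

theorem IsFreeBasis.of_triangular (hb : IsFreeBasis R b)
    (hw : ∀ i, w i - c i • b i ∈ Submodule.span R (b '' {j | d j < d i})) : IsFreeBasis R w := by
  refine ⟨linearIndependent_of_triangular hb.1 hw, top_unique ?_⟩
  let N := Submodule.span R (Set.range w)
  have hmem (n : ℕ) : ∀ i, d i = n → b i ∈ N := by
    induction n using Nat.strong_induction_on with
    | _ n ih =>
      rintro i rfl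
      have hlow : w i - c i • b i ∈ N := by
        refine Submodule.span_le.2 ?_ (hw i)
        rintro _ ⟨j, hj, rfl⟩
        exact ih (d j) hj j rfl
      have hwi : w i ∈ N := Submodule.subset_span ⟨i, rfl⟩
      exact (N.smul_mem_iff' (c i)).1 ((N.sub_mem_iff_right hwi).1 hlow)
  rw [← hb.2, Submodule.span_le]
  rintro _ ⟨i, rfl⟩
  exact hmem _ i rfl

theorem IsFreeBasis.reindex {ι' : Type*} (hb : IsFreeBasis R b) (e : ι' ≃ ι) :
    IsFreeBasis R (b ∘ e) :=
  ⟨hb.1.comp e e.injective, by rw [e.surjective.range_comp, hb.2]⟩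

end Triangular

section Monomials

variable {K B : Type*} [Field K] [Ring B] [Algebra K B] {A : Subalgebra K B} {x y : B} {q : K}
  {n : ℕ}

/-- The monomial `xⁱ yʲ`, for a pair `(i, j)` of exponents. -/
def monomial (x y : B) (m : ℕ × ℕ) : B := x ^ m.1 * y ^ m.2

/-- The left `A`-span of the monomials `xⁱ yʲ` of total degree `i + j < n`. -/
def totalDegreeLT (A : Subalgebra K B) (x y : B) (n : ℕ) : Submodule A B :=
  Submodule.span A (monomial x y '' {m | m.1 + m.2 < n})

theorem pow_mul_pow_mem_totalDegreeLT {i j : ℕ} (h : i + j < n) :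
    x ^ i * y ^ j ∈ totalDegreeLT A x y n :=
  Submodule.subset_span ⟨(i, j), h, rfl⟩

theorem totalDegreeLT_mono : Monotone (totalDegreeLT A x y) := fun _ _ h =>
  Submodule.span_mono (Set.image_mono fun _ hm => lt_of_lt_of_le hm h)

theorem linear_mul_mem_totalDegreeLT {l s : B} (hl : l ∈ leftLinear A x y)
    (hs : s ∈ totalDegreeLT A x y n) (hxs : x * s ∈ totalDegreeLT A x y (n + 1))
    (hys : y * s ∈ totalDegreeLT A x y (n + 1)) : l * s ∈ totalDegreeLT A x y (n + 1) := by
  obtain ⟨a, b, c, rfl⟩ := hl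
  rw [add_mul, add_mul, mul_assoc, mul_assoc]
  exact add_mem (add_mem (Submodule.smul_mem _ a hxs) (Submodule.smul_mem _ b hys))
    (Submodule.smul_mem _ c (totalDegreeLT_mono n.le_succ hs))

section Reversal

variable (hx : ∀ a : A, x * a ∈ leftLinear A x y) (hy : ∀ a : A, y * a ∈ leftLinear A x y)

include hx hy in
theorem var_mul_mem_totalDegreeLT {s : B} (hs : s ∈ totalDegreeLT A x y n)
    (hn : ∀ i j, i + j < n →
      y * (x ^ i * y ^ j) - q ^ i • (x ^ i * y ^ (j + 1)) ∈ totalDegreeLT A x y (i + j + 1)) :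
    x * s ∈ totalDegreeLT A x y (n + 1) ∧ y * s ∈ totalDegreeLT A x y (n + 1) := by
  induction hs using Submodule.span_induction with
  | mem s hs =>
    obtain ⟨⟨i, j⟩, hij, rfl⟩ := hs
    have hij : i + j < n := hij
    constructor
    · rw [monomial, ← mul_assoc, ← pow_succ']
      exact pow_mul_pow_mem_totalDegreeLT (by omega)
    · have hlead : q ^ i • (x ^ i * y ^ (j + 1)) ∈ totalDegreeLT A x y (n + 1) :=
        Submodule.smul_of_tower_mem _ _ (pow_mul_pow_mem_totalDegreeLT (by omega))
      exact (Submodule.sub_mem_iff_left _ hlead).1 (totalDegreeLT_mono (by omega) (hn i j hij))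
  | zero => simp only [mul_zero, zero_mem, and_self]
  | add s t _ _ hs ht =>
    rw [mul_add, mul_add]
    exact ⟨add_mem hs.1 ht.1, add_mem hs.2 ht.2⟩
  | smul a s hs h =>
    rw [Subalgebra.smul_def, smul_eq_mul, ← mul_assoc, ← mul_assoc]
    exact ⟨linear_mul_mem_totalDegreeLT (hx a) hs h.1 h.2,
      linear_mul_mem_totalDegreeLT (hy a) hs h.1 h.2⟩

variable (hq : y * x - q • (x * y) ∈ leftLinear A x y)

include hx hy hq

theorem snd_mul_monomial_sub_mem_totalDegreeLT (i j : ℕ) :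
    y * (x ^ i * y ^ j) - q ^ i • (x ^ i * y ^ (j + 1)) ∈ totalDegreeLT A x y (i + j + 1) := by
  induction hn : i + j using Nat.strong_induction_on generalizing i j with
  | _ n ih =>
  subst hn
  have hvar {k : ℕ} (hk : k ≤ i + j) {s : B} (hs : s ∈ totalDegreeLT A x y k) :=
    var_mul_mem_totalDegreeLT hx hy hs fun i' j' h => ih _ (h.trans_le hk) i' j' rfl
  cases i with
  | zero => simp [← pow_succ']
  | succ i =>
    have hs := pow_mul_pow_mem_totalDegreeLT (A := A) (x := x) (y := y) (Nat.lt_succ_self (i + j))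
    have hlow := hvar (by omega) hs
    have hmono := hvar (by omega) (ih (i + j) (by omega) i j rfl)
    have hrel := linear_mul_mem_totalDegreeLT hq hs hlow.1 hlow.2
    have heq : y * (x ^ (i + 1) * y ^ j) - q ^ (i + 1) • (x ^ (i + 1) * y ^ (j + 1))
        = q • (x * (y * (x ^ i * y ^ j) - q ^ i • (x ^ i * y ^ (j + 1))))
          + (y * x - q • (x * y)) * (x ^ i * y ^ j) := by
      simp only [pow_succ' x i, pow_succ' q i, mul_sub, sub_mul, smul_sub, mul_smul, mul_assoc,
        mul_smul_comm, smul_mul_assoc]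
      abel
    rw [heq, add_right_comm i 1 j]
    exact add_mem (Submodule.smul_of_tower_mem _ q hmono.1) hrel

theorem snd_mul_mem_totalDegreeLT {s : B} (hs : s ∈ totalDegreeLT A x y n) :
    y * s ∈ totalDegreeLT A x y (n + 1) :=
  (var_mul_mem_totalDegreeLT hx hy hs fun i j _ =>
    snd_mul_monomial_sub_mem_totalDegreeLT hx hy hq i j).2

theorem snd_pow_mul_fst_pow_sub_mem_totalDegreeLT (i j : ℕ) :
    y ^ j * x ^ i - q ^ (i * j) • (x ^ i * y ^ j) ∈ totalDegreeLT A x y (i + j) := by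
  induction j with
  | zero => simp
  | succ j ih =>
    have heq : y ^ (j + 1) * x ^ i - q ^ (i * (j + 1)) • (x ^ i * y ^ (j + 1))
        = y * (y ^ j * x ^ i - q ^ (i * j) • (x ^ i * y ^ j))
          + q ^ (i * j) • (y * (x ^ i * y ^ j) - q ^ i • (x ^ i * y ^ (j + 1))) := by
      rw [mul_sub, mul_smul_comm, smul_sub, smul_smul, ← pow_add, ← mul_assoc y, ← pow_succ',
        Nat.mul_succ]
      abel
    rw [heq]
    exact add_mem (snd_mul_mem_totalDegreeLT hx hy hq ih) (Submodule.smul_of_tower_mem _ _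
      (snd_mul_monomial_sub_mem_totalDegreeLT hx hy hq i j))

theorem IsFreeBasis.monomial_swap (hq₀ : q ≠ 0) (hb : IsFreeBasis A (monomial x y)) :
    IsFreeBasis A (monomial y x) := by
  let c (m : ℕ × ℕ) : Aˣ := Units.map (algebraMap K A : K →* A) (Units.mk0 q hq₀ ^ (m.1 * m.2))
  have hrev : IsFreeBasis A (monomial y x ∘ Prod.swap) :=
    hb.of_triangular (c := c) (d := fun m => m.1 + m.2) fun m => by
      have hc : c m • monomial x y m = q ^ (m.1 * m.2) • (x ^ m.1 * y ^ m.2) :=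
        algebraMap_smul A (q ^ (m.1 * m.2)) (x ^ m.1 * y ^ m.2)
      rw [hc]
      exact snd_pow_mul_fst_pow_sub_mem_totalDegreeLT hx hy hq m.1 m.2
  exact hrev.reindex (Equiv.prodComm ℕ ℕ)

end Reversal

end Monomials

section Symmetries

variable {K B : Type*} [Field K] [Ring B] [Algebra K B] {A : Subalgebra K B} {y₁ y₂ : B}

theorem leftLinear_comm (A : Subalgebra K B) (x y : B) : leftLinear A x y = leftLinear A y x := by
  ext b
  constructor <;> rintro ⟨a₁, a₂, a₀, rfl⟩ <;> exact ⟨a₂, a₁, a₀, by abel⟩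

theorem rightLinear_comm (A : Subalgebra K B) (x y : B) :
    rightLinear A x y = rightLinear A y x := by
  ext b
  constructor <;> rintro ⟨a₁, a₂, a₀, rfl⟩ <;> exact ⟨a₂, a₁, a₀, by abel⟩

theorem leftLinear_op (A : Subalgebra K B) (x y : B) :
    leftLinear A.op (op x) (op y) = unop ⁻¹' rightLinear A x y := by
  ext b
  constructor
  · rintro ⟨a₁, a₂, a₀, rfl⟩
    exact ⟨⟨_, a₁.2⟩, ⟨_, a₂.2⟩, ⟨_, a₀.2⟩, rfl⟩
  · rintro ⟨a₁, a₂, a₀, h⟩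
    exact ⟨⟨op a₁, a₁.2⟩, ⟨op a₂, a₂.2⟩, ⟨op a₀, a₀.2⟩, unop_injective h⟩

theorem rightLinear_op (A : Subalgebra K B) (x y : B) :
    rightLinear A.op (op x) (op y) = unop ⁻¹' leftLinear A x y := by
  ext b
  constructor
  · rintro ⟨a₁, a₂, a₀, rfl⟩
    exact ⟨⟨_, a₁.2⟩, ⟨_, a₂.2⟩, ⟨_, a₀.2⟩, rfl⟩
  · rintro ⟨a₁, a₂, a₀, h⟩
    exact ⟨⟨op a₁, a₁.2⟩, ⟨op a₂, a₂.2⟩, ⟨op a₀, a₀.2⟩, unop_injective h⟩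

variable {p₁₂ p₁₁ : K} {τ₀ τ₁ τ₂ : A}

theorem IsRightDoubleExtension.monomial_swap
    (hB : IsRightDoubleExtension A y₁ y₂ p₁₂ 0 τ₀ τ₁ τ₂) (hp : p₁₂ ≠ 0) :
    IsFreeBasis A (monomial y₂ y₁) := by
  refine hB.left_basis.monomial_swap (x := y₁) (y := y₂) (q := p₁₂)
    (fun a => hB.right_subset_left ⟨a, 0, 0, by simp⟩)
    (fun a => hB.right_subset_left ⟨0, a, 0, by simp⟩) ?_ hp
  exact ⟨τ₁, τ₂, τ₀, by rw [hB.relation]; simp only [zero_smul, add_zero]; abel⟩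

namespace IsDoubleExtension

theorem exists_op (hB : IsDoubleExtension A y₁ y₂ p₁₂ p₁₁ τ₀ τ₁ τ₂) : ∃ t₀ t₁ t₂ : A.op,
    IsRightDoubleExtension A.op (op y₁) (op y₂) p₁₂⁻¹ (-(p₁₂⁻¹ * p₁₁)) t₀ t₁ t₂ := by
  have htail : (τ₁ * y₁ + τ₂ * y₂ + τ₀ : B) ∈ rightLinear A y₁ y₂ :=
    hB.right_eq_left ▸ ⟨τ₁, τ₂, τ₀, rfl⟩
  obtain ⟨b₁, b₂, b₀, hb⟩ := htail
  refine ⟨-(p₁₂⁻¹ • ⟨op b₀, b₀.2⟩), -(p₁₂⁻¹ • ⟨op b₁, b₁.2⟩), -(p₁₂⁻¹ • ⟨op b₂, b₂.2⟩),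
    ?_, ?_, hB.right_basis.reindex (Equiv.prodComm ℕ ℕ), ?_⟩
  · have h := congrArg Subalgebra.op hB.generated
    rw [Subalgebra.op_adjoin, Subalgebra.op_top] at h
    rw [← h]
    congr 1
    ext b
    simp [← unop_inj (x := b)]
  · apply unop_injective
    have hrel : p₁₂ • (y₁ * y₂) = y₂ * y₁ - p₁₁ • y₁ ^ 2 - (y₁ * b₁ + y₂ * b₂ + b₀) := by
      rw [hB.relation, ← hb]
      abel
    change y₁ * y₂ = p₁₂⁻¹ • (y₂ * y₁) + -(p₁₂⁻¹ * p₁₁) • y₁ ^ 2 + y₁ * -(p₁₂⁻¹ • (b₁ : B))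
      + y₂ * -(p₁₂⁻¹ • (b₂ : B)) + -(p₁₂⁻¹ • (b₀ : B))
    rw [(eq_inv_smul_iff₀ hB.p₁₂_ne_zero).2 hrel]
    simp only [smul_sub, smul_add, neg_smul, mul_smul, mul_neg, mul_smul_comm]
    abel
  · rw [rightLinear_op, leftLinear_op, hB.right_eq_left]

theorem swap (hB : IsDoubleExtension A y₁ y₂ p₁₂ 0 τ₀ τ₁ τ₂) :
    IsDoubleExtension A y₂ y₁ p₁₂⁻¹ 0 (-(p₁₂⁻¹ • τ₀)) (-(p₁₂⁻¹ • τ₂)) (-(p₁₂⁻¹ • τ₁)) := by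
  have heq : rightLinear A y₂ y₁ = leftLinear A y₂ y₁ := by
    rw [rightLinear_comm, leftLinear_comm, hB.right_eq_left]
  obtain ⟨t₀, t₁, t₂, hop⟩ := hB.exists_op
  rw [mul_zero, neg_zero] at hop
  refine ⟨⟨by rw [Set.pair_comm, hB.generated], ?_, hB.monomial_swap hB.p₁₂_ne_zero, heq.subset⟩,
    inv_ne_zero hB.p₁₂_ne_zero,
    (hop.monomial_swap (inv_ne_zero hB.p₁₂_ne_zero)).reindex (Equiv.prodComm ℕ ℕ), heq⟩
  have hrel : p₁₂ • (y₁ * y₂) = y₂ * y₁ - (τ₁ * y₁ + τ₂ * y₂ + τ₀) := by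
    rw [hB.relation, zero_smul]
    abel
  rw [(eq_inv_smul_iff₀ hB.p₁₂_ne_zero).2 hrel]
  push_cast
  simp only [smul_sub, smul_add, zero_smul, neg_mul, smul_mul_assoc]
  abel

end IsDoubleExtension

end Symmetries

section Independence

variable {K B : Type*} [Field K] [Ring B] [Algebra K B] {A : Subalgebra K B} {x y : B}

theorem coeffs_eq_zero_of_quadratic (h : LinearIndependent A (monomial x y)) {a b c d e : A}
    (habc : a * x ^ 2 + b * (x * y) + c * x + d * y + e = 0) : a = 0 ∧ b = 0 ∧ c = 0 ∧ d = 0 := by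
  have hinj : Function.Injective ![((2, 0) : ℕ × ℕ), (1, 1), (1, 0), (0, 1), (0, 0)] := by decide
  have hcoeff := Fintype.linearIndependent_iff.1 (h.comp _ hinj) ![a, b, c, d, e] (by
    simpa [Fin.sum_univ_succ, monomial, Subalgebra.smul_def, add_assoc] using habc)
  exact ⟨hcoeff 0, hcoeff 1, hcoeff 2, hcoeff 3⟩

theorem linearIndependent_pow_of_monomial (h : LinearIndependent A (monomial x y)) :
    LinearIndependent A (fun n : ℕ => x ^ n) := by
  convert h.comp (fun n : ℕ => (n, 0)) (Prod.mk_left_injective 0) using 2 with n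
  simp [monomial]

theorem eq_zero_of_mul_pow_mem_degreeLT (h : LinearIndependent A fun n : ℕ => x ^ n) {n : ℕ}
    {a : A} (ha : (a : B) * x ^ n ∈ degreeLT (A.val : A →+* B) x n) : a = 0 := by
  refine linearIndependent_iff_eq_zero_of_smul_mem_span.1 h n a ?_
  let N := Submodule.span A ((fun n : ℕ => x ^ n) '' (Set.univ \ {n}))
  have hle : degreeLT (A.val : A →+* B) x n ≤ N.toAddSubgroup := degreeLT_le fun i hi r =>
    N.smul_mem r (Submodule.subset_span ⟨i, ⟨trivial, hi.ne⟩, rfl⟩)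
  exact hle ha

theorem eq_zero_of_mul_snd_pow_mem_degreeLT (h : LinearIndependent A (monomial x y))
    {C : Subalgebra K B} (hC : ∀ c ∈ C, c ∈ Submodule.span A (Set.range fun n : ℕ => x ^ n))
    {n : ℕ} {c : C} (hc : (c : B) * y ^ n ∈ degreeLT (C.val : C →+* B) y n) : c = 0 := by
  have hmul (j : ℕ) (c : C) :
      (c : B) * y ^ j ∈ Submodule.span A (monomial x y '' {m | m.2 = j}) := by
    have := Submodule.mem_map_of_mem (f := LinearMap.mulRight A (y ^ j)) (hC c c.2)
    rw [Submodule.map_span] at this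
    refine Submodule.span_mono ?_ this
    rintro _ ⟨_, ⟨i, rfl⟩, rfl⟩
    exact ⟨(i, j), rfl, rfl⟩
  have hlow : (c : B) * y ^ n ∈ Submodule.span A (monomial x y '' {m | m.2 < n}) := by
    let N := Submodule.span A (monomial x y '' {m | m.2 < n})
    have hle : degreeLT (C.val : C →+* B) y n ≤ N.toAddSubgroup := degreeLT_le fun i hi r => by
      have hsub : {m : ℕ × ℕ | m.2 = i} ⊆ {m | m.2 < n} := fun m (hm : m.2 = i) => hm.trans_lt hi
      exact Submodule.span_mono (Set.image_mono hsub) (hmul i r)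
    exact hle hc
  have hdisj : Disjoint {m : ℕ × ℕ | m.2 = n} {m | m.2 < n} :=
    Set.disjoint_left.2 fun m (hm : m.2 = n) (hm' : m.2 < n) => hm'.ne hm
  have hzero : (c : B) * y ^ n = 0 :=
    Submodule.disjoint_def.1 (h.disjoint_span_image hdisj) _ (hmul n c) hlow
  have hker : LinearIndependent A (LinearMap.mulRight A (y ^ n) ∘ fun i : ℕ => x ^ i) :=
    h.comp (fun i : ℕ => (i, n)) (Prod.mk_left_injective n)
  exact Subtype.ext
    (Submodule.disjoint_def.1 (Submodule.range_ker_disjoint hker) _ (hC c c.2) hzero)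

end Independence

section Adjoin

variable {K B : Type*} [Field K] [Ring B] [Algebra K B] {A : Subalgebra K B} {x y : B}

/-- The subalgebra of `B` generated by the subalgebra `A` and the element `x`. -/
def adjoinVar (A : Subalgebra K B) (x : B) : Subalgebra K B :=
  Algebra.adjoin K (insert x (A : Set B))

theorem le_adjoinVar (A : Subalgebra K B) (x : B) : A ≤ adjoinVar A x := fun _ ha =>
  Algebra.subset_adjoin (Set.mem_insert_of_mem x ha)

theorem self_mem_adjoinVar (A : Subalgebra K B) (x : B) : x ∈ adjoinVar A x :=
  Algebra.subset_adjoin (Set.mem_insert x A)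

/-- The inclusion of `A` into `adjoinVar A x`. -/
abbrev adjoinVar.incl (A : Subalgebra K B) (x : B) : A →ₐ[K] adjoinVar A x :=
  Subalgebra.inclusion (le_adjoinVar A x)

/-- The element `x`, viewed in `adjoinVar A x`. -/
abbrev adjoinVar.var (A : Subalgebra K B) (x : B) : adjoinVar A x := ⟨x, self_mem_adjoinVar A x⟩

theorem adjoinVar_op (A : Subalgebra K B) (x : B) :
    adjoinVar A.op (op x) = (adjoinVar A x).op := by
  rw [adjoinVar, adjoinVar, Subalgebra.op_adjoin]
  congr 1
  ext b
  simp [← unop_inj (x := b)]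

theorem exists_mul_eq_of_mem_adjoin {X : Set B}
    (hX : ∀ b ∈ X, ∃ c ∈ Algebra.adjoin K X, ∃ d ∈ Algebra.adjoin K X, y * b = c * y + d)
    {b : B} (hb : b ∈ Algebra.adjoin K X) :
    ∃ c ∈ Algebra.adjoin K X, ∃ d ∈ Algebra.adjoin K X, y * b = c * y + d := by
  induction hb using Algebra.adjoin_induction with
  | mem b hb => exact hX b hb
  | algebraMap k =>
    exact ⟨_, Subalgebra.algebraMap_mem _ k, 0, zero_mem _, by rw [add_zero, Algebra.commutes]⟩
  | add b b' _ _ hb hb' =>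
    obtain ⟨c, hc, d, hd, h⟩ := hb
    obtain ⟨c', hc', d', hd', h'⟩ := hb'
    exact ⟨c + c', add_mem hc hc', d + d', add_mem hd hd', by rw [mul_add, h, h', add_mul]; abel⟩
  | mul b b' _ hb₀ hb hb' =>
    obtain ⟨c, hc, d, hd, h⟩ := hb
    obtain ⟨c', hc', d', hd', h'⟩ := hb'
    refine ⟨c * c', mul_mem hc hc', c * d' + d * b', add_mem (mul_mem hc hd') (mul_mem hd hb₀), ?_⟩
    rw [← mul_assoc, h, add_mul, mul_assoc, h', mul_add, mul_assoc, add_assoc]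

theorem op_mul_op_pow_one_mem_degreeLT {a d : A} (h : x * a = d) :
    op (a : B) * op x ^ 1 ∈ degreeLT (A.op.val : A.op →+* Bᵐᵒᵖ) (op x) 1 := by
  have hax : op (a : B) * op x ^ 1 = op (d : B) * op x ^ 0 := by
    rw [pow_one, pow_zero, mul_one, ← op_mul, h]
  exact hax ▸ map_mul_pow_mem_degreeLT (ι := (A.op.val : A.op →+* Bᵐᵒᵖ)) (y := op x)
    zero_lt_one ⟨op (d : B), d.2⟩

theorem exists_isOreExtension_adjoinVar
    (hL : ∀ a : A, ∃ a' d : A, x * a = a' * x + d) (hR : ∀ a : A, ∃ a' d : A, a * x = x * a' + d)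
    (hli : LinearIndependent A fun n : ℕ => x ^ n)
    (hop : LinearIndependent A.op fun n : ℕ => op x ^ n) :
    ∃ σ, IsOreExtension (adjoinVar.incl A x : A →+* adjoinVar A x) σ (adjoinVar.var A x) := by
  refine exists_isOreExtension ?_ (fun a => ?_) (fun a => ?_) (fun n a h => ?_) (fun a d h => ?_)
  · refine Eq.trans ?_ (Algebra.adjoin_adjoin_coe_preimage (R := K) (s := insert x (A : Set B)))
    congr 1
    ext ⟨b, hb⟩
    constructor
    · rintro (hbx | ⟨a, ha⟩)
      · exact Or.inl (congrArg Subtype.val hbx)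
      · exact Or.inr (congrArg Subtype.val ha ▸ a.2)
    · rintro (hbx | ha)
      · exact Or.inl (Subtype.ext hbx)
      · exact Or.inr ⟨⟨b, ha⟩, rfl⟩
  · obtain ⟨a', d, h⟩ := hL a
    exact ⟨a', d, Subtype.ext h⟩
  · obtain ⟨a', d, h⟩ := hR a
    exact ⟨a', d, Subtype.ext h⟩
  · have hle : degreeLT (adjoinVar.incl A x : A →+* adjoinVar A x) (adjoinVar.var A x) n
        ≤ (degreeLT (A.val : A →+* B) x n).comap (adjoinVar A x).val :=
      degreeLT_le fun i hi r => map_mul_pow_mem_degreeLT hi r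
    exact eq_zero_of_mul_pow_mem_degreeLT hli (hle h)
  · have := eq_zero_of_mul_pow_mem_degreeLT (A := A.op) hop (a := ⟨op (a : B), a.2⟩)
      (op_mul_op_pow_one_mem_degreeLT (congrArg Subtype.val h))
    exact Subtype.ext (congrArg unop (congrArg Subtype.val this))

theorem mem_span_pow_of_isOreExtension {σ : A ≃+* A}
    (h : IsOreExtension (adjoinVar.incl A x : A →+* adjoinVar A x) σ (adjoinVar.var A x))
    {c : B} (hc : c ∈ adjoinVar A x) :
    c ∈ Submodule.span A (Set.range fun n : ℕ => x ^ n) := by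
  let N := Submodule.span A (Set.range fun n : ℕ => x ^ n)
  obtain ⟨n, hn⟩ := h.exhaust ⟨c, hc⟩
  have hle : degreeLT (adjoinVar.incl A x : A →+* adjoinVar A x) (adjoinVar.var A x) n
      ≤ N.toAddSubgroup.comap (adjoinVar A x).val :=
    degreeLT_le fun i _ r => N.smul_mem r (Submodule.subset_span ⟨i, rfl⟩)
  exact hle hn

theorem op_mem_span_pow_of_isOreExtension {σ : A ≃+* A}
    (h : IsOreExtension (adjoinVar.incl A x : A →+* adjoinVar A x) σ (adjoinVar.var A x))
    {c : B} (hc : c ∈ adjoinVar A x) :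
    op c ∈ Submodule.span A.op (Set.range fun n : ℕ => op x ^ n) := by
  let N := Submodule.span A.op (Set.range fun n : ℕ => op x ^ n)
  obtain ⟨n, hn⟩ := h.exhaust ⟨c, hc⟩
  have hle : degreeLT (RingHom.op (adjoinVar.incl A x : A →+* adjoinVar A x))
      (op (adjoinVar.var A x)) n
      ≤ N.toAddSubgroup.comap (RingHom.op (adjoinVar A x).val : (adjoinVar A x)ᵐᵒᵖ →+* Bᵐᵒᵖ) :=
    degreeLT_le fun i _ r => N.smul_mem ⟨op (r.unop : B), r.unop.2⟩ (Submodule.subset_span ⟨i, rfl⟩)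
  exact hle ((op_mem_degreeLT_op h.comm).2 hn)

end Adjoin

section Tower

variable {K B : Type*} [Field K] [Ring B] [Algebra K B] {A : Subalgebra K B} {y₁ y₂ : B}
  {p₁₂ p₁₁ : K} {τ₀ τ₁ τ₂ : A}

theorem IsRightDoubleExtension.exists_snd_mul_eq
    (hB : IsRightDoubleExtension A y₁ y₂ p₁₂ p₁₁ τ₀ τ₁ τ₂) (c : adjoinVar A y₁) :
    ∃ c' d : adjoinVar A y₁, y₂ * c = c' * y₂ + d := by
  have hA : ∀ a : A, (a : B) ∈ adjoinVar A y₁ := fun a => le_adjoinVar A y₁ a.2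
  have hy : y₁ ∈ adjoinVar A y₁ := self_mem_adjoinVar A y₁
  suffices hgen : ∀ b ∈ insert y₁ (A : Set B),
      ∃ c ∈ adjoinVar A y₁, ∃ d ∈ adjoinVar A y₁, y₂ * b = c * y₂ + d by
    obtain ⟨c', hc', d, hd, h⟩ := exists_mul_eq_of_mem_adjoin hgen c.2
    exact ⟨⟨c', hc'⟩, ⟨d, hd⟩, h⟩
  rintro b (rfl | hb)
  · refine ⟨p₁₂ • b + τ₂, add_mem (Subalgebra.smul_mem _ hy _) (hA τ₂),
      p₁₁ • b ^ 2 + τ₁ * b + τ₀, add_mem (add_mem (Subalgebra.smul_mem _ (pow_mem hy 2) _)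
        (mul_mem (hA τ₁) hy)) (hA τ₀), ?_⟩
    rw [hB.relation, add_mul, smul_mul_assoc]
    abel
  · obtain ⟨s, t, e, h⟩ := hB.right_subset_left ⟨0, ⟨b, hb⟩, 0, rfl⟩
    simp only [ZeroMemClass.coe_zero, mul_zero, zero_add, add_zero] at h
    refine ⟨t, hA t, s * y₁ + e, add_mem (mul_mem (hA s) hy) (hA e), ?_⟩
    rw [h]
    abel

namespace IsDoubleExtension

variable (hB : IsDoubleExtension A y₁ y₂ p₁₂ p₁₁ τ₀ τ₁ τ₂)
include hB

theorem coeffs_eq_zero_of_rightLinear {a b c : A} (h : y₁ * a + y₂ * b = c) :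
    a = 0 ∧ b = 0 := by
  obtain ⟨t₀, t₁, t₂, hop⟩ := hB.exists_op
  have hzero : op (a : B) * op y₁ + op (b : B) * op y₂ + op (-(c : B)) = 0 := by
    rw [← op_mul, ← op_mul, ← op_add, ← op_add, h, add_neg_cancel, op_zero]
  obtain ⟨-, -, ha, hb⟩ := coeffs_eq_zero_of_quadratic hop.left_basis.1
    (a := 0) (b := 0) (c := ⟨op (a : B), a.2⟩) (d := ⟨op (b : B), b.2⟩)
    (e := ⟨op (-(c : B)), (-c).2⟩) (by simpa using hzero)
  exact ⟨Subtype.ext (congrArg unop (congrArg Subtype.val ha)),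
    Subtype.ext (congrArg unop (congrArg Subtype.val hb))⟩

theorem adjoin_insert_range_val_eq_top :
    Algebra.adjoin K (insert y₂ (Set.range (adjoinVar A y₁).val)) = ⊤ := by
  refine top_le_iff.1 (hB.generated ▸ Algebra.adjoin_le ?_)
  have hC : ∀ c ∈ adjoinVar A y₁,
      c ∈ Algebra.adjoin K (insert y₂ (Set.range (adjoinVar A y₁).val)) := fun c hc =>
    Algebra.subset_adjoin (Or.inr ⟨⟨c, hc⟩, rfl⟩)
  rintro b (hb | rfl | rfl)
  · exact hC b (le_adjoinVar A y₁ hb)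
  · exact hC b (self_mem_adjoinVar A b)
  · exact Algebra.subset_adjoin (Or.inl rfl)

/-- Compare coefficients at `y₁ y₂` and `y₁²` in `y₂ (y₁ b) = (y₂ y₁) b`. -/
theorem coeffs_eq_of_assoc (hlow : ∀ a : A, ∃ a' d : A, y₁ * a = a' * y₁ + d)
    {b s e u d t v z w g : A} (hb : y₂ * b = s * y₁ + e) (hu : y₁ * b = u * y₁ + d)
    (hv : y₂ * u = t * y₁ + v * y₂ + z) (hw : y₁ * ↑(p₁₂ • s + p₁₁ • u) = w * y₁ + g) :
    v = 0 ∧ t = w := by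
  obtain ⟨f₁, f₂, f₀, hf⟩ := hB.right_subset_left ⟨0, d, 0, rfl⟩
  simp only [ZeroMemClass.coe_zero, mul_zero, zero_add, add_zero] at hf
  obtain ⟨e₁, e₀, he⟩ := hlow e
  obtain ⟨d₁, d₀, hd⟩ := hlow d
  have hleft : y₂ * (y₁ * b) = t * y₁ ^ 2 + v * (p₁₂ • (y₁ * y₂) + p₁₁ • y₁ ^ 2 + τ₁ * y₁
      + τ₂ * y₂ + τ₀) + z * y₁ + (f₁ * y₁ + f₂ * y₂ + f₀) := by
    rw [hu, mul_add, ← mul_assoc, hv, hf, add_mul, add_mul, mul_assoc, mul_assoc, ← sq,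
      hB.relation]
  have hright : y₂ * (y₁ * b) = w * y₁ ^ 2 + g * y₁ + p₁₂ • (e₁ * y₁ + e₀)
      + p₁₁ • (d₁ * y₁ + d₀) + τ₁ * (u * y₁ + d) + τ₂ * (s * y₁ + e) + τ₀ * b := by
    have hw' : w * y₁ ^ 2 + g * y₁ = p₁₂ • (y₁ * s * y₁) + p₁₁ • (y₁ * u * y₁) := by
      rw [sq, ← mul_assoc, ← add_mul, ← hw]
      push_cast
      simp only [mul_add, add_mul, mul_smul_comm, smul_mul_assoc]
    rw [hw', ← mul_assoc, hB.relation, ← he, ← hd, ← hu, ← hb]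
    simp only [add_mul, smul_mul_assoc, mul_assoc, hb, hu, sq, mul_add, smul_add]
    abel
  obtain ⟨h₂₀, h₁₁, -, -⟩ := coeffs_eq_zero_of_quadratic hB.left_basis.1
    (a := t + p₁₁ • v - w) (b := p₁₂ • v)
    (c := v * τ₁ + z + f₁ - g - p₁₂ • e₁ - p₁₁ • d₁ - τ₁ * u - τ₂ * s) (d := v * τ₂ + f₂)
    (e := v * τ₀ + f₀ - p₁₂ • e₀ - p₁₁ • d₀ - τ₁ * d - τ₂ * e - τ₀ * b) (by
      rw [← sub_eq_zero.2 (hleft.symm.trans hright)]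
      push_cast
      simp only [mul_add, add_mul, sub_mul, mul_smul_comm, smul_mul_assoc, smul_add, mul_assoc]
      abel)
  have hv₀ : v = 0 := (smul_eq_zero_iff_right hB.p₁₂_ne_zero).1 h₁₁
  exact ⟨hv₀, by simpa [hv₀, sub_eq_zero] using h₂₀⟩

theorem eq_zero_of_snd_mul_eq (hlow : ∀ a : A, ∃ a' d : A, y₁ * a = a' * y₁ + d) {b s e : A}
    (hb : y₂ * b = s * y₁ + e) : b = 0 := by
  obtain ⟨u, d, hu⟩ := hlow b
  obtain ⟨t, v, z, hv⟩ := hB.right_subset_left ⟨0, u, 0, rfl⟩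
  simp only [ZeroMemClass.coe_zero, mul_zero, zero_add, add_zero] at hv
  obtain ⟨w, g, hw⟩ := hlow (p₁₂ • s + p₁₁ • u)
  obtain ⟨rfl, rfl⟩ := hB.coeffs_eq_of_assoc hlow hb hu hv hw
  have hu₀ : u = 0 := by
    refine (hB.coeffs_eq_zero_of_rightLinear (a := -(p₁₂ • s + p₁₁ • u)) (c := z - g) ?_).2
    rw [hv, NegMemClass.coe_neg, mul_neg, hw, ZeroMemClass.coe_zero, zero_mul,
      AddSubgroupClass.coe_sub]
    abel
  exact (hB.coeffs_eq_zero_of_rightLinear (a := b) (b := 0) (c := d) (by simp [hu, hu₀])).1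

theorem exists_mul_fst_eq (hlow : ∀ a : A, ∃ a' d : A, y₁ * a = a' * y₁ + d) (a : A) :
    ∃ a' d : A, a * y₁ = y₁ * a' + d := by
  obtain ⟨b₁, b₂, b₀, h⟩ : (a * y₁ : B) ∈ rightLinear A y₁ y₂ :=
    hB.right_eq_left ▸ ⟨a, 0, 0, by simp⟩
  obtain ⟨c, c₀, hc⟩ := hlow b₁
  have hb₂ : b₂ = 0 := hB.eq_zero_of_snd_mul_eq hlow (s := a - c) (e := -(c₀ + b₀)) (by
    rw [hc] at h
    push_cast
    rw [sub_mul, h]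
    abel)
  exact ⟨b₁, b₀, by simpa [hb₂] using h⟩

theorem exists_isOreExtension_fst (hlow : ∀ a : A, ∃ a' d : A, y₁ * a = a' * y₁ + d) :
    ∃ σ, IsOreExtension (adjoinVar.incl A y₁ : A →+* adjoinVar A y₁) σ (adjoinVar.var A y₁) := by
  obtain ⟨_, _, _, hop⟩ := hB.exists_op
  exact exists_isOreExtension_adjoinVar hlow (hB.exists_mul_fst_eq hlow)
    (linearIndependent_pow_of_monomial hB.left_basis.1)
    (linearIndependent_pow_of_monomial hop.left_basis.1)

theorem exists_isOreExtension_snd {σ : A ≃+* A}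
    (h : IsOreExtension (adjoinVar.incl A y₁ : A →+* adjoinVar A y₁) σ (adjoinVar.var A y₁)) :
    ∃ σ', IsOreExtension ((adjoinVar A y₁).val : adjoinVar A y₁ →+* B) σ' y₂ := by
  obtain ⟨_, _, _, hop⟩ := hB.exists_op
  refine exists_isOreExtension hB.adjoin_insert_range_val_eq_top hB.exists_snd_mul_eq
    (fun c => ?_) (fun n c hc => ?_) (fun c d hcd => ?_)
  · have hex := hop.exists_snd_mul_eq
    rw [adjoinVar_op] at hex
    obtain ⟨c', d, hc⟩ := hex ⟨op (c : B), c.2⟩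
    exact ⟨⟨_, c'.2⟩, ⟨_, d.2⟩, congrArg unop hc⟩
  · exact eq_zero_of_mul_snd_pow_mem_degreeLT hB.left_basis.1
      (fun _ => mem_span_pow_of_isOreExtension h) hc
  · have := eq_zero_of_mul_snd_pow_mem_degreeLT (C := (adjoinVar A y₁).op) hop.left_basis.1
      (fun _ => op_mem_span_pow_of_isOreExtension h) (c := ⟨op (c : B), c.2⟩)
      (op_mul_op_pow_one_mem_degreeLT hcd)
    exact Subtype.ext (congrArg unop (congrArg Subtype.val this))

theorem transfersTo (hlow : ∀ a : A, ∃ a' d : A, y₁ * a = a' * y₁ + d) : TransfersTo A B := by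
  obtain ⟨_, h₁⟩ := hB.exists_isOreExtension_fst hlow
  obtain ⟨_, h₂⟩ := hB.exists_isOreExtension_snd h₁
  exact h₁.transfersTo.trans h₂.transfersTo

end IsDoubleExtension

end Tower

end DoubleOre

theorem corollary2p5 {K B : Type*} [Field K] [Ring B] [Algebra K B] (A : Subalgebra K B)
    (y₁ y₂ : B) (p₁₂ p₁₁ : K) (τ₀ τ₁ τ₂ : A)
    (σ : A → Matrix (Fin 2) (Fin 2) A) (δ : A → Fin 2 → A)
    (hB : DoubleOre.IsDoubleExtension A y₁ y₂ p₁₂ p₁₁ τ₀ τ₁ τ₂)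
    (hσδ : DoubleOre.IsStructureMaps A y₁ y₂ σ δ)
    (h : (∀ a, σ a 0 1 = 0) ∨ ((∀ a, σ a 1 0 = 0) ∧ p₁₁ = 0)) :
    (DoubleOre.IsLeftNoetherian A → DoubleOre.IsLeftNoetherian B) ∧
    (DoubleOre.IsRightNoetherian A → DoubleOre.IsRightNoetherian B) ∧
    (IsDomain A → IsDomain B) ∧
    (DoubleOre.IsPrimeRing A → DoubleOre.IsPrimeRing B) ∧
    (DoubleOre.IsSemiprimeRing A ∧ DoubleOre.IsLeftNoetherian A →
      DoubleOre.IsSemiprimeRing B ∧ DoubleOre.IsLeftNoetherian B) ∧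
    (DoubleOre.IsSemiprimeRing A ∧ DoubleOre.IsRightNoetherian A →
      DoubleOre.IsSemiprimeRing B ∧ DoubleOre.IsRightNoetherian B) ∧
    (DoubleOre.IsSemiprimeRing A ∧ DoubleOre.IsLeftGoldie A →
      DoubleOre.IsSemiprimeRing B ∧ DoubleOre.IsLeftGoldie B) ∧
    (DoubleOre.IsSemiprimeRing A ∧ DoubleOre.IsRightGoldie A →
      DoubleOre.IsSemiprimeRing B ∧ DoubleOre.IsRightGoldie B) := by
  rcases h with h₁₂ | ⟨h₂₁, rfl⟩
  · exact hB.transfersTo fun a => ⟨σ a 0 0, δ a 0, by simpa [h₁₂ a] using (hσδ a).1⟩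
  · exact hB.swap.transfersTo fun a => ⟨σ a 1 1, δ a 1, by simpa [h₂₁ a] using (hσδ a).2⟩
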